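/- Let $\mathbb{K}$ be a field of characteristic zero and $S=\mathbb{K}[x_1,x_2,x_3]$. Let $\mathcal{A}$ be a finite set of linear hyperplanes in $\mathbb{K}^3$ with $\bigcap_{L\in\mathcal{A}}L=\{0\}$ (an essential line arrangement in $\mathbb{P}^2$), let $H\in\mathcal{A}$, and put $\mathcal{A}'=\mathcal{A}\setminus\{H\}$ and $\mathcal{A}^H=\{H\cap L \mid L\in\mathcal{A}'\}$. For a finite set $\mathcal{B}$ of linear hyperplanes $L=\ker\alpha_L$ in $\mathbb{K}^3$, let $D(\mathcal{B})$ be the $S$-module of all derivations $\theta\in\operatorname{Der}_{\mathbb{K}}(S)$ with $\theta(\alpha_L)\in S\alpha_L$ for every $L\in\mathcal{B}$. A derivation is homogeneous of degree $e$ if it is nonzero and sends every linear form to zero or to a form of degree $e$. Let $r(\mathcal{B})$ be the least $e$ for which there is a homogeneous derivation $\theta\neq 0$ of degree $e$ with $\theta\bigl(\prod_{L\in\mathcal{B}}\alpha_L\bigr)=0$. We say that $\mathcal{B}$ is free with exponents $(1,d_2,d_3)$ if $D(\mathcal{B})$ is a free $S$-module with a basis $\theta_E,\theta_2,\theta_3$,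 where $\theta_E=\sum_i x_i\partial_{x_i}$ and $\theta_2,\theta_3$ are homogeneous of degrees $d_2,d_3$. Let $d_2\le d_3$ be non-negative integers. (1) Assume that $\mathcal{A}$ is free with exponents $(1,d_2,d_3)$. Then $r(\mathcal{A}')=d_2-1$ if and only if $|\mathcal{A}^H|=1+d_3$. Otherwise $r(\mathcal{A}')=d_2$. (2) Assume that $\mathcal{A}'$ is free with exponents $(1,d_2,d_3)$. Then $r(\mathcal{A})=d_2+1$ if and only if $|\mathcal{A}^H|\neq 1+d_2$. Otherwise $r(\mathcal{A})=d_2$. -/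

import Mathlib

open MvPolynomial

noncomputable section

/-- A (central) hyperplane arrangement in `K ^ ℓ`: a finite set of linear hyperplanes, that is, of
kernels of nonzero linear forms. For `ℓ = 3` this is a line arrangement in the projective plane. -/
structure HyperplaneArrangement (K : Type*) [Field K] (ℓ : ℕ) where
  /-- The hyperplanes of the arrangement. -/
  hyperplanes : Finset (Submodule K (Fin ℓ → K))
  isHyperplane : ∀ H ∈ hyperplanes,
    ∃ α : Module.Dual K (Fin ℓ → K), α ≠ 0 ∧ LinearMap.ker α = H

namespace HyperplaneArrangement

variable {K : Type*} [Field K] {ℓ : ℕ}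

/-- The arrangement is essential: its hyperplanes meet only in the origin. -/
def IsEssential (A : HyperplaneArrangement K ℓ) : Prop :=
  (⨅ H ∈ A.hyperplanes, H) = ⊥

open Classical in
/-- The deletion `A ∖ {H}`. -/
def deletion (A : HyperplaneArrangement K ℓ) (H : Submodule K (Fin ℓ → K)) :
    HyperplaneArrangement K ℓ where
  hyperplanes := A.hyperplanes.erase H
  isHyperplane := fun L hL => A.isHyperplane L (Finset.mem_of_mem_erase hL)

open Classical in
/-- The restriction `A^H = {H ∩ L | L ∈ A ∖ {H}}`, as a set of subspaces of `K ^ ℓ`. -/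
def restriction (A : HyperplaneArrangement K ℓ) (H : Submodule K (Fin ℓ → K)) :
    Finset (Submodule K (Fin ℓ → K)) :=
  (A.hyperplanes.erase H).image (fun L => H ⊓ L)

/-- A linear form on `K ^ ℓ`, as a homogeneous polynomial of degree one in the coordinates. -/
def linearPoly (α : Module.Dual K (Fin ℓ → K)) : MvPolynomial (Fin ℓ) K :=
  ∑ i, C (α (Pi.single i 1)) * X i

open Classical in
/-- A fixed linear form `α_H` with kernel the hyperplane `H`, as a polynomial
(the value `0` occurs only when `H` is not a hyperplane). -/
def definingPoly (H : Submodule K (Fin ℓ → K)) : MvPolynomial (Fin ℓ) K :=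
  if h : ∃ α : Module.Dual K (Fin ℓ → K), α ≠ 0 ∧ LinearMap.ker α = H then
    linearPoly h.choose
  else 0

/-- The defining polynomial `Q(A)`, the product of the linear forms `α_H` with `H ∈ A`. -/
def Q (A : HyperplaneArrangement K ℓ) : MvPolynomial (Fin ℓ) K :=
  ∏ H ∈ A.hyperplanes, definingPoly H

/-- The module `Der S` of `K`-linear derivations of `S = K[x_1, …, x_ℓ]`. -/
abbrev Der (K : Type*) [Field K] (ℓ : ℕ) : Type _ :=
  Derivation K (MvPolynomial (Fin ℓ) K) (MvPolynomial (Fin ℓ) K)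

/-- The derivation `θ` is zero or homogeneous of degree `e`: it sends linear forms to
forms of degree `e` (zero allowed). -/
def IsHomogeneousDer (θ : Der K ℓ) (e : ℕ) : Prop :=
  ∀ g : MvPolynomial (Fin ℓ) K, g.IsHomogeneous 1 → (θ g).IsHomogeneous e

/-- The Euler derivation `θ_E = ∑ x_i ∂_{x_i}`. -/
def eulerDer (K : Type*) [Field K] (ℓ : ℕ) : Der K ℓ :=
  ∑ i, (X i : MvPolynomial (Fin ℓ) K) • pderiv i

/-- The logarithmic derivation module
`D(A) = {θ ∈ Der S | θ(α_H) ∈ S α_H for all H ∈ A}`. -/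
def logDer (A : HyperplaneArrangement K ℓ) :
    Submodule (MvPolynomial (Fin ℓ) K) (Der K ℓ) where
  carrier := {θ | ∀ H ∈ A.hyperplanes, θ (definingPoly H) ∈ Ideal.span {definingPoly H}}
  zero_mem' := fun H _ => by simp
  add_mem' := fun ha hb H hH => by
    simpa using Ideal.add_mem _ (ha H hH) (hb H hH)
  smul_mem' := fun c θ hθ H hH => by
    simpa using Ideal.mul_mem_left _ c (hθ H hH)

/-- The submodule `D_0(A) = {θ ∈ Der S | θ(Q(A)) = 0}`. -/
def logDerZero (A : HyperplaneArrangement K ℓ) :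
    Submodule (MvPolynomial (Fin ℓ) K) (Der K ℓ) where
  carrier := {θ | θ A.Q = 0}
  zero_mem' := by simp
  add_mem' := fun {a b} ha hb => by
    simp only [Set.mem_ofPred_eq] at ha hb ⊢
    simp [ha, hb]
  smul_mem' := fun c θ hθ => by
    simp only [Set.mem_ofPred_eq] at hθ ⊢
    simp [hθ]

/-- The invariant `r(A)`: the least `r` with `D_0(A)_r ≠ 0`. -/
def r (A : HyperplaneArrangement K ℓ) : ℕ :=
  sInf {e : ℕ | ∃ θ ∈ A.logDerZero, θ ≠ 0 ∧ IsHomogeneousDer θ e}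

/-- `A` is free with exponents `d`: the `S`-module `D(A)` has a basis of homogeneous derivations of
degrees `d 0, d 1, …`, the first of which is the Euler derivation. -/
def IsFreeWithExponents [NeZero ℓ] (A : HyperplaneArrangement K ℓ) (d : Fin ℓ → ℕ) : Prop :=
  ∃ b : Module.Basis (Fin ℓ) (MvPolynomial (Fin ℓ) K) A.logDer,
    (b 0 : Der K ℓ) = eulerDer K ℓ ∧ ∀ i, IsHomogeneousDer (b i : Der K ℓ) (d i)

end HyperplaneArrangement

end

/-! In characteristic zero θ_E(Q) is a nonzero multiple of Q for nonempty B, so subtracting a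
multiple of θ_E makes any element of D(B) kill Q. Hence r(B) is the least degree of a homogeneous
element of D(B) outside S θ_E (`r_eq_sInf`). As D(A) ⊆ D(A') and α_H D(A') ⊆ D(A), only two values
are possible: d₂ − 1 or d₂ in (1), d₂ or d₂ + 1 in (2).

Two divisibilities modulo α_H let |A^H| decide. For θ ∈ D(A), the determinant of θ_E and θ
restricted to the plane H is divisible by the product R of the |A^H| distinct restricted forms. For
θ ∈ D(A'), the product N of all restricted α_L, L ∈ A', divides θ(α_H) R.

If r takes the smaller value, a derivation realizing it yields, via Saito's criterion
(`exists_det_basis_eq`), φ ∈ D(A') and ψ ∈ D(A) with det(θ_E, φ, ψ) = c Q(A'), c ≠ 0. Since α_H does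
not divide Q(A'), neither restricted expression vanishes, and comparing degrees gives |A^H| = 1 +
deg ψ (`card_restriction_eq`).

Conversely, for the critical |A^H| the divisor has the degree expected of the value at θ₃. So θ₂, or
a combination of θ₂ and θ₃ when d₂ = d₃, has value zero (`exists_apply_eq_zero`). In (1) this means
θ = g θ_E + α_H φ with φ ∈ D(A') of degree d₂ − 1; in (2) it means θ ∈ D(A). -/

open MvPolynomial

noncomputable section

/-! ### Factors of homogeneous polynomials -/

namespace MvPolynomial

variable {σ R : Type*} [CommRing R]

lemma IsHomogeneous.homogeneousComponent_mul {p : MvPolynomial σ R} {m : ℕ}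
    (hp : p.IsHomogeneous m) (q : MvPolynomial σ R) (n : ℕ) :
    homogeneousComponent n (p * q) =
      if m ≤ n then p * homogeneousComponent (n - m) q else 0 := by
  let _ : GradedAlgebra (homogeneousSubmodule σ R) := gradedAlgebra
  have h : ∀ (f : MvPolynomial σ R) (k : ℕ),
      (DirectSum.decompose (homogeneousSubmodule σ R) f k : MvPolynomial σ R) =
        homogeneousComponent k f := fun f k => decomposition.decompose'_apply f k
  rw [← h, ← h]
  exact DirectSum.coe_decompose_mul_of_left_mem (homogeneousSubmodule σ R) n
    ((mem_homogeneousSubmodule m p).2 hp)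

lemma IsHomogeneous.of_mul_left [IsDomain R] {p q : MvPolynomial σ R} {m k : ℕ}
    (hp : p.IsHomogeneous m) (hp0 : p ≠ 0) (hpq : (p * q).IsHomogeneous (m + k)) :
    q.IsHomogeneous k := by
  have h := hp.homogeneousComponent_mul q (m + k)
  rw [homogeneousComponent_eq_self hpq, if_pos (Nat.le_add_right m k),
    Nat.add_sub_cancel_left] at h
  rw [mul_left_cancel₀ hp0 h]
  exact homogeneousComponent_isHomogeneous k q

lemma IsHomogeneous.eq_zero_of_mul_left [IsDomain R] {p q : MvPolynomial σ R} {m n : ℕ}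
    (hp : p.IsHomogeneous m) (hp0 : p ≠ 0) (hpq : (p * q).IsHomogeneous n) (hnm : n < m) :
    q = 0 := by
  have h := hp.homogeneousComponent_mul q n
  rw [homogeneousComponent_eq_self hpq, if_neg (by omega)] at h
  exact (mul_eq_zero.1 h).resolve_left hp0

lemma IsHomogeneous.eq_C {p : MvPolynomial σ R} (hp : p.IsHomogeneous 0) : ∃ c, p = C c :=
  ⟨coeff 0 p, (totalDegree_eq_zero_iff_eq_C).1 (Nat.le_zero.1 hp.totalDegree_le)⟩

lemma IsHomogeneous.le_of_dvd [IsDomain R] {p q : MvPolynomial σ R} {m n : ℕ}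
    (hp : p.IsHomogeneous m) (hq : q.IsHomogeneous n) (hq0 : q ≠ 0) (h : p ∣ q) : m ≤ n := by
  obtain ⟨u, rfl⟩ := h
  by_contra! hlt
  exact hq0 (by rw [hp.eq_zero_of_mul_left (left_ne_zero_of_mul hq0) hq hlt, mul_zero])

lemma IsHomogeneous.exists_eq_C_mul_of_dvd [IsDomain R] {p q : MvPolynomial σ R} {m : ℕ}
    (hp : p.IsHomogeneous m) (hq : q.IsHomogeneous m) (hp0 : p ≠ 0) (h : p ∣ q) :
    ∃ c, q = C c * p := by
  obtain ⟨u, rfl⟩ := h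
  obtain ⟨c, hc⟩ := (hp.of_mul_left (k := 0) hp0 hq).eq_C
  exact ⟨c, by rw [hc, mul_comm]⟩

end MvPolynomial

/-! ### Linear forms and elimination of a variable -/

namespace HyperplaneArrangement

variable {K : Type*} [Field K] {ℓ : ℕ}

/-- `linearPoly` as a linear map. -/
def linearPolyHom (K : Type*) [Field K] (ℓ : ℕ) :
    Module.Dual K (Fin ℓ → K) →ₗ[K] MvPolynomial (Fin ℓ) K where
  toFun := linearPoly
  map_add' a b := by simp [linearPoly, add_mul, Finset.sum_add_distrib]
  map_smul' c a := by simp [linearPoly, Finset.mul_sum, mul_assoc, smul_eq_C_mul]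

lemma linearPoly_add (a b : Module.Dual K (Fin ℓ → K)) :
    linearPoly (a + b) = linearPoly a + linearPoly b := map_add (linearPolyHom K ℓ) a b

lemma linearPoly_sub (a b : Module.Dual K (Fin ℓ → K)) :
    linearPoly (a - b) = linearPoly a - linearPoly b := map_sub (linearPolyHom K ℓ) a b

lemma linearPoly_smul (c : K) (a : Module.Dual K (Fin ℓ → K)) :
    linearPoly (c • a) = C c * linearPoly a := by
  rw [← smul_eq_C_mul]; exact map_smul (linearPolyHom K ℓ) c a

lemma coeff_linearPoly (a : Module.Dual K (Fin ℓ → K)) (i : Fin ℓ) :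
    coeff (Finsupp.single i 1) (linearPoly a) = a (Pi.single i 1) := by
  classical
  simp [linearPoly, coeff_sum, coeff_C_mul, coeff_X, Finsupp.single_left_inj]

lemma linearPoly_injective :
    Function.Injective (linearPoly : Module.Dual K (Fin ℓ → K) → MvPolynomial (Fin ℓ) K) := by
  intro a b h
  apply LinearMap.pi_ext'
  intro i
  ext
  simpa [coeff_linearPoly] using congrArg (coeff (Finsupp.single i 1)) h

lemma linearPoly_ne_zero {a : Module.Dual K (Fin ℓ → K)} (ha : a ≠ 0) : linearPoly a ≠ 0 := by
  intro h
  exact ha (linearPoly_injective (h.trans (map_zero (linearPolyHom K ℓ)).symm))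

lemma isHomogeneous_linearPoly (a : Module.Dual K (Fin ℓ → K)) :
    (linearPoly a).IsHomogeneous 1 :=
  IsHomogeneous.sum _ _ _ fun i _ => isHomogeneous_C_mul_X _ i

lemma exists_apply_single_ne_zero {a : Module.Dual K (Fin ℓ → K)} (ha : a ≠ 0) :
    ∃ j, a (Pi.single j 1) ≠ 0 := by
  by_contra! h
  apply ha
  apply LinearMap.pi_ext'
  intro i
  ext
  simpa using h i

/-- The substitution eliminating the variable `X j` by means of the linear equation `a = 0`. -/
def elim (a : Module.Dual K (Fin ℓ → K)) (j : Fin ℓ) :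
    MvPolynomial (Fin ℓ) K →ₐ[K] MvPolynomial (Fin ℓ) K :=
  aeval fun i => if i = j then X j - C (a (Pi.single j 1))⁻¹ * linearPoly a else X i

lemma elim_X_of_ne (a : Module.Dual K (Fin ℓ → K)) {i j : Fin ℓ} (h : i ≠ j) :
    elim a j (X i) = X i := by simp [elim, h]

lemma elim_X_self (a : Module.Dual K (Fin ℓ → K)) (j : Fin ℓ) :
    elim a j (X j) = X j - C (a (Pi.single j 1))⁻¹ * linearPoly a := by simp [elim]

lemma elim_C (a : Module.Dual K (Fin ℓ → K)) (j : Fin ℓ) (c : K) :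
    elim a j (C c) = C c := by
  simp [elim]

lemma dvd_sub_elim (a : Module.Dual K (Fin ℓ → K)) (j : Fin ℓ) (f : MvPolynomial (Fin ℓ) K) :
    linearPoly a ∣ f - elim a j f := by
  induction f using MvPolynomial.induction_on with
  | C c => simp
  | add p q hp hq =>
    rw [map_add, add_sub_add_comm]
    exact dvd_add hp hq
  | mul_X p i hp =>
    have hi : linearPoly a ∣ X i - elim a j (X i) := by
      by_cases h : i = j
      · subst h
        rw [elim_X_self, sub_sub_cancel]
        exact dvd_mul_left _ _
      · simp [elim_X_of_ne a h]
    have : p * X i - elim a j (p * X i) =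
        (p - elim a j p) * X i + elim a j p * (X i - elim a j (X i)) := by
      rw [map_mul]; ring
    rw [this]
    exact dvd_add (hp.mul_right _) (hi.mul_left _)

lemma elim_linearPoly (a b : Module.Dual K (Fin ℓ → K)) (j : Fin ℓ) :
    elim a j (linearPoly b) =
      linearPoly b - C (b (Pi.single j 1) * (a (Pi.single j 1))⁻¹) * linearPoly a := by
  have : ∀ i, elim a j (X i) =
      X i - if i = j then C (a (Pi.single j 1))⁻¹ * linearPoly a else 0 := by
    intro i
    by_cases h : i = j
    · subst h; simp [elim_X_self]
    · simp [elim_X_of_ne a h, h]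
  conv_lhs => rw [linearPoly]
  simp only [map_sum, map_mul, elim_C, this, mul_sub, Finset.sum_sub_distrib, mul_ite, mul_zero,
    Finset.sum_ite_eq', Finset.mem_univ, if_true]
  rw [← linearPoly, mul_assoc]

lemma elim_linearPoly_eq (a b : Module.Dual K (Fin ℓ → K)) (j : Fin ℓ) :
    elim a j (linearPoly b) =
      linearPoly (b - (b (Pi.single j 1) * (a (Pi.single j 1))⁻¹) • a) := by
  rw [elim_linearPoly, linearPoly_sub, linearPoly_smul]

lemma elim_self {a : Module.Dual K (Fin ℓ → K)} {j : Fin ℓ} (h : a (Pi.single j 1) ≠ 0) :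
    elim a j (linearPoly a) = 0 := by
  rw [elim_linearPoly, mul_inv_cancel₀ h]; simp

/-- Elimination thus models the quotient by `linearPoly a` inside the polynomial ring itself, where
degrees and primes stay available. -/
lemma elim_eq_zero_iff {a : Module.Dual K (Fin ℓ → K)} {j : Fin ℓ} (h : a (Pi.single j 1) ≠ 0)
    {f : MvPolynomial (Fin ℓ) K} : elim a j f = 0 ↔ linearPoly a ∣ f := by
  constructor
  · intro hf
    simpa [hf] using dvd_sub_elim a j f
  · rintro ⟨g, rfl⟩
    rw [map_mul, elim_self h, zero_mul]

lemma isHomogeneous_elim (a : Module.Dual K (Fin ℓ → K)) (j : Fin ℓ)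
    {f : MvPolynomial (Fin ℓ) K} {n : ℕ} (hf : f.IsHomogeneous n) :
    (elim a j f).IsHomogeneous n := by
  have := hf.aeval (R := K) (S := K) (n := 1)
    (fun i => if i = j then X j - C (a (Pi.single j 1))⁻¹ * linearPoly a else X i) (by
      intro i
      split_ifs
      · exact (isHomogeneous_X _ _).sub ((isHomogeneous_linearPoly a).C_mul _)
      · exact isHomogeneous_X _ _)
  rwa [one_mul] at this

/-- The ideal generated by the form is the kernel of a ring map into a domain. -/
lemma prime_linearPoly {a : Module.Dual K (Fin ℓ → K)} (ha : a ≠ 0) : Prime (linearPoly a) := by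
  obtain ⟨j, hj⟩ := exists_apply_single_ne_zero ha
  refine ⟨linearPoly_ne_zero ha, fun hu => ?_, fun p q h => ?_⟩
  · have := (elim_eq_zero_iff hj).2 (hu.dvd (a := 1))
    simp at this
  · simp only [← elim_eq_zero_iff hj, map_mul, mul_eq_zero] at h ⊢
    exact h

lemma exists_smul_of_linearPoly_dvd {a b : Module.Dual K (Fin ℓ → K)} (ha : a ≠ 0)
    (h : linearPoly a ∣ linearPoly b) : ∃ c : K, b = c • a := by
  obtain ⟨c, hc⟩ := (isHomogeneous_linearPoly a).exists_eq_C_mul_of_dvd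
    (isHomogeneous_linearPoly b) (linearPoly_ne_zero ha) h
  exact ⟨c, linearPoly_injective (by rw [hc, linearPoly_smul])⟩

end HyperplaneArrangement

/-! ### Defining polynomials and logarithmic derivations -/

namespace HyperplaneArrangement

variable {K : Type*} [Field K] {ℓ : ℕ}

lemma exists_definingPoly_eq {H : Submodule K (Fin ℓ → K)}
    (h : ∃ α : Module.Dual K (Fin ℓ → K), α ≠ 0 ∧ LinearMap.ker α = H) :
    ∃ a : Module.Dual K (Fin ℓ → K), a ≠ 0 ∧ LinearMap.ker a = H ∧
      definingPoly H = linearPoly a :=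
  ⟨h.choose, h.choose_spec.1, h.choose_spec.2, by rw [definingPoly, dif_pos h]⟩

variable (A : HyperplaneArrangement K ℓ) {H L : Submodule K (Fin ℓ → K)}

lemma isHomogeneous_definingPoly (H : Submodule K (Fin ℓ → K)) :
    (definingPoly H).IsHomogeneous 1 := by
  unfold definingPoly
  split_ifs
  · exact isHomogeneous_linearPoly _
  · exact isHomogeneous_zero _ _ _

variable {A}

lemma prime_definingPoly (hH : H ∈ A.hyperplanes) : Prime (definingPoly H) := by
  obtain ⟨a, ha, -, h⟩ := exists_definingPoly_eq (A.isHyperplane H hH)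
  rw [h]
  exact prime_linearPoly ha

lemma eq_of_definingPoly_dvd (hH : H ∈ A.hyperplanes) (hL : L ∈ A.hyperplanes)
    (h : definingPoly H ∣ definingPoly L) : H = L := by
  obtain ⟨a, ha, rfl, hpa⟩ := exists_definingPoly_eq (A.isHyperplane H hH)
  obtain ⟨b, hb, rfl, hpb⟩ := exists_definingPoly_eq (A.isHyperplane L hL)
  rw [hpa, hpb] at h
  obtain ⟨c, rfl⟩ := exists_smul_of_linearPoly_dvd ha h
  have hc : c ≠ 0 := by rintro rfl; simp at hb
  exact (LinearMap.ker_smul a c hc).symm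

lemma pairwise_isRelPrime_definingPoly (s : Finset (Submodule K (Fin ℓ → K)))
    (hs : s ⊆ A.hyperplanes) :
    (s : Set (Submodule K (Fin ℓ → K))).Pairwise (Function.onFun IsRelPrime definingPoly) := by
  intro H hH L hL hne
  exact (prime_definingPoly (hs hH)).irreducible.isRelPrime_iff_not_dvd.2
    fun h => hne (eq_of_definingPoly_dvd (hs hH) (hs hL) h)

lemma Q_dvd {f : MvPolynomial (Fin ℓ) K} (h : ∀ H ∈ A.hyperplanes, definingPoly H ∣ f) :
    A.Q ∣ f :=
  Finset.prod_dvd_of_isRelPrime (pairwise_isRelPrime_definingPoly _ subset_rfl) h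

lemma definingPoly_dvd_Q (hH : H ∈ A.hyperplanes) : definingPoly H ∣ A.Q :=
  Finset.dvd_prod_of_mem _ hH

lemma Q_ne_zero : A.Q ≠ 0 :=
  Finset.prod_ne_zero_iff.2 fun _ hH => (prime_definingPoly hH).ne_zero

variable (A) in
lemma isHomogeneous_Q : A.Q.IsHomogeneous A.hyperplanes.card := by
  simpa [Q] using IsHomogeneous.prod A.hyperplanes definingPoly (fun _ => 1)
    fun H _ => isHomogeneous_definingPoly H

lemma Q_deletion (hH : H ∈ A.hyperplanes) : A.Q = definingPoly H * (A.deletion H).Q := by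
  classical
  rw [Q, Q, deletion, ← Finset.mul_prod_erase _ _ hH]

lemma mem_deletion : L ∈ (A.deletion H).hyperplanes ↔ L ≠ H ∧ L ∈ A.hyperplanes := by
  classical
  rw [deletion, Finset.mem_erase]

lemma not_definingPoly_dvd_Q_deletion (hH : H ∈ A.hyperplanes) :
    ¬ definingPoly H ∣ (A.deletion H).Q := by
  intro h
  obtain ⟨L, hL, hd⟩ := ((prime_definingPoly hH).dvd_finsetProd_iff _).1 h
  rw [mem_deletion] at hL
  exact hL.1 (eq_of_definingPoly_dvd hH hL.2 hd).symm

lemma mem_logDer {θ : Der K ℓ} :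
    θ ∈ A.logDer ↔ ∀ H ∈ A.hyperplanes, definingPoly H ∣ θ (definingPoly H) := by
  simp only [← Ideal.mem_span_singleton]
  rfl

lemma mem_logDerZero {θ : Der K ℓ} : θ ∈ A.logDerZero ↔ θ A.Q = 0 := Iff.rfl

lemma logDer_le_logDer_deletion : A.logDer ≤ (A.deletion H).logDer := by
  intro θ hθ
  rw [mem_logDer] at hθ ⊢
  exact fun L hL => hθ L (mem_deletion.1 hL).2

lemma mem_logDer_of_deletion {θ : Der K ℓ} (hθ : θ ∈ (A.deletion H).logDer)
    (h : definingPoly H ∣ θ (definingPoly H)) : θ ∈ A.logDer := by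
  rw [mem_logDer] at hθ ⊢
  intro L hL
  by_cases hLH : L = H
  · rwa [hLH]
  · exact hθ L (mem_deletion.2 ⟨hLH, hL⟩)

lemma smul_mem_logDer {θ : Der K ℓ} (hθ : θ ∈ (A.deletion H).logDer) :
    definingPoly H • θ ∈ A.logDer :=
  mem_logDer_of_deletion (Submodule.smul_mem _ _ hθ) (by simp)

lemma mem_logDer_deletion_of_smul {θ : Der K ℓ} (hH : H ∈ A.hyperplanes)
    (hθ : definingPoly H • θ ∈ A.logDer) : θ ∈ (A.deletion H).logDer := by
  rw [mem_logDer] at hθ ⊢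
  intro L hL
  rw [mem_deletion] at hL
  have := hθ L hL.2
  rw [Derivation.smul_apply, smul_eq_mul] at this
  exact ((prime_definingPoly hL.2).dvd_or_dvd this).resolve_left
    fun h => hL.1 (eq_of_definingPoly_dvd hL.2 hH h)

lemma Q_dvd_apply_Q {θ : Der K ℓ} (hθ : θ ∈ A.logDer) : A.Q ∣ θ A.Q := by
  rw [mem_logDer] at hθ
  refine Q_dvd fun H hH => ?_
  rw [Q_deletion hH, Derivation.leibniz, smul_eq_mul, smul_eq_mul]
  exact dvd_add (dvd_mul_right _ _) ((hθ H hH).mul_left _)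

/-- By Leibniz on Q = α_H Q', the prime α_H divides Q' θ(α_H), and it does not divide Q'. -/
lemma logDerZero_le_logDer : A.logDerZero ≤ A.logDer := by
  intro θ hθ
  rw [mem_logDerZero] at hθ
  rw [mem_logDer]
  intro H hH
  rw [Q_deletion hH, Derivation.leibniz, smul_eq_mul, smul_eq_mul] at hθ
  have : definingPoly H ∣ (A.deletion H).Q * θ (definingPoly H) :=
    (dvd_add_right (dvd_mul_right _ _)).1 (hθ ▸ dvd_zero _)
  exact ((prime_definingPoly hH).dvd_or_dvd this).resolve_left (not_definingPoly_dvd_Q_deletion hH)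

lemma der_sum_apply {ι : Type*} (s : Finset ι) (θ : ι → Der K ℓ) (f : MvPolynomial (Fin ℓ) K) :
    (∑ i ∈ s, θ i) f = ∑ i ∈ s, θ i f := by
  classical
  induction s using Finset.induction_on with
  | empty => simp
  | insert a s ha ih => rw [Finset.sum_insert ha, Finset.sum_insert ha, Derivation.add_apply, ih]

lemma der_apply_eq_sum (θ : Der K ℓ) (f : MvPolynomial (Fin ℓ) K) :
    θ f = ∑ i, θ (X i) * pderiv i f := by
  have : θ = ∑ i, θ (X i) • pderiv i := by
    apply derivation_ext
    intro j
    simp [der_sum_apply, pderiv_X, Pi.single_apply]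
  conv_lhs => rw [this]
  simp [der_sum_apply]

lemma der_C_mul (θ : Der K ℓ) (c : K) (f : MvPolynomial (Fin ℓ) K) :
    θ (C c * f) = C c * θ f := by
  rw [← smul_eq_C_mul, Derivation.map_smul, smul_eq_C_mul]

lemma der_linearPoly (θ : Der K ℓ) (a : Module.Dual K (Fin ℓ → K)) :
    θ (linearPoly a) = ∑ i, C (a (Pi.single i 1)) * θ (X i) := by
  simp [linearPoly]

lemma isHomogeneousDer_iff {θ : Der K ℓ} {e : ℕ} :
    IsHomogeneousDer θ e ↔ ∀ i, (θ (X i)).IsHomogeneous e := by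
  refine ⟨fun h i => h _ (isHomogeneous_X K i), fun h g hg => ?_⟩
  rw [der_apply_eq_sum]
  refine IsHomogeneous.sum _ _ _ fun i _ => ?_
  simpa using (h i).mul hg.pderiv

lemma IsHomogeneousDer.apply {θ : Der K ℓ} {e n : ℕ} (hθ : IsHomogeneousDer θ e)
    {f : MvPolynomial (Fin ℓ) K} (hf : f.IsHomogeneous n) :
    (θ f).IsHomogeneous (e + (n - 1)) := by
  rw [der_apply_eq_sum]
  exact IsHomogeneous.sum _ _ _ fun i _ => (isHomogeneousDer_iff.1 hθ i).mul hf.pderiv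

lemma IsHomogeneousDer.add {θ φ : Der K ℓ} {e : ℕ} (hθ : IsHomogeneousDer θ e)
    (hφ : IsHomogeneousDer φ e) : IsHomogeneousDer (θ + φ) e :=
  fun g hg => (hθ g hg).add (hφ g hg)

lemma IsHomogeneousDer.sub {θ φ : Der K ℓ} {e : ℕ} (hθ : IsHomogeneousDer θ e)
    (hφ : IsHomogeneousDer φ e) : IsHomogeneousDer (θ - φ) e :=
  fun g hg => (hθ g hg).sub (hφ g hg)

lemma IsHomogeneousDer.smul {θ : Der K ℓ} {e m : ℕ} (hθ : IsHomogeneousDer θ e)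
    {f : MvPolynomial (Fin ℓ) K} (hf : f.IsHomogeneous m) : IsHomogeneousDer (f • θ) (m + e) :=
  fun g hg => hf.mul (hθ g hg)

lemma IsHomogeneousDer.C_smul {θ : Der K ℓ} {e : ℕ} (hθ : IsHomogeneousDer θ e) (c : K) :
    IsHomogeneousDer ((C c : MvPolynomial (Fin ℓ) K) • θ) e := by
  have h := hθ.smul (isHomogeneous_C (σ := Fin ℓ) c)
  rwa [zero_add] at h

/-! ### The Euler derivation and the invariant r -/

@[simp]
lemma eulerDer_X (i : Fin ℓ) : eulerDer K ℓ (X i) = X i := by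
  simp [eulerDer, der_sum_apply, pderiv_X, Pi.single_apply]

lemma eulerDer_apply {f : MvPolynomial (Fin ℓ) K} {n : ℕ} (hf : f.IsHomogeneous n) :
    eulerDer K ℓ f = n * f := by
  rw [der_apply_eq_sum]
  simpa using hf.sum_X_mul_pderiv

lemma isHomogeneousDer_eulerDer : IsHomogeneousDer (eulerDer K ℓ) 1 :=
  isHomogeneousDer_iff.2 fun i => by simpa using isHomogeneous_X K i

lemma eulerDer_mem_logDer : eulerDer K ℓ ∈ A.logDer :=
  mem_logDer.2 fun H _ => by simp [eulerDer_apply (isHomogeneous_definingPoly H)]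

/-- The derivations that are not multiples of the Euler derivation. -/
def IsNonEuler (θ : Der K ℓ) : Prop := ∀ g : MvPolynomial (Fin ℓ) K, θ ≠ g • eulerDer K ℓ

/-- In characteristic zero, `r(A)` is the least degree of a homogeneous element of `D(A)` that is
not a multiple of the Euler derivation. -/
lemma r_eq_sInf [CharZero K] (hA : A.hyperplanes.Nonempty) :
    A.r = sInf {e : ℕ | ∃ θ ∈ A.logDer, IsNonEuler θ ∧ IsHomogeneousDer θ e} := by
  have hn : A.hyperplanes.card ≠ 0 := Finset.card_ne_zero.2 hA
  have hnK : (A.hyperplanes.card : K) ≠ 0 := Nat.cast_ne_zero.2 hn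
  have hE : eulerDer K ℓ A.Q = C (A.hyperplanes.card : K) * A.Q := by
    rw [eulerDer_apply (isHomogeneous_Q A), map_natCast]
  rw [r]
  congr 1
  ext e
  constructor
  · rintro ⟨θ, hθ, h0, he⟩
    refine ⟨θ, logDerZero_le_logDer hθ, ?_, he⟩
    rintro g rfl
    rw [mem_logDerZero, Derivation.smul_apply, hE, smul_eq_mul] at hθ
    have : g = 0 := by
      simpa [Q_ne_zero, hn] using hθ
    simp [this] at h0
  · rintro ⟨θ, hθ, hne, he⟩
    obtain ⟨g, hg⟩ := Q_dvd_apply_Q hθ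
    refine ⟨θ - (C (A.hyperplanes.card : K)⁻¹ * g) • eulerDer K ℓ, ?_, ?_, ?_⟩
    · rw [mem_logDerZero, Derivation.sub_apply, Derivation.smul_apply, hE, hg, smul_eq_mul]
      have : C (A.hyperplanes.card : K)⁻¹ * C (A.hyperplanes.card : K) =
          (1 : MvPolynomial (Fin ℓ) K) := by rw [← C_mul, inv_mul_cancel₀ hnK, C_1]
      linear_combination (-g * A.Q) * this
    · exact sub_ne_zero.2 (hne _)
    · have hhom := he.apply (isHomogeneous_Q A)
      rw [hg] at hhom
      -- θ(Q) has degree e + |A| − 1, so g has degree e − 1; for e = 0 it must vanish.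
      by_cases he0 : e = 0
      · have : g = 0 := (isHomogeneous_Q A).eq_zero_of_mul_left Q_ne_zero hhom (by omega)
        simpa [this] using he
      · have hgh : g.IsHomogeneous (e - 1) := by
          refine (isHomogeneous_Q A).of_mul_left Q_ne_zero ?_
          rwa [show A.hyperplanes.card + (e - 1) = e + (A.hyperplanes.card - 1) by omega]
        refine he.sub ?_
        convert isHomogeneousDer_eulerDer.smul (hgh.C_mul _) using 1
        omega

lemma r_le [CharZero K] (hA : A.hyperplanes.Nonempty) {θ : Der K ℓ} {e : ℕ} (hθ : θ ∈ A.logDer)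
    (hne : IsNonEuler θ) (he : IsHomogeneousDer θ e) : A.r ≤ e := by
  rw [r_eq_sInf hA]
  exact Nat.sInf_le ⟨θ, hθ, hne, he⟩

lemma exists_isHomogeneousDer_r [CharZero K] (hA : A.hyperplanes.Nonempty) {θ : Der K ℓ} {e : ℕ}
    (hθ : θ ∈ A.logDer) (hne : IsNonEuler θ) (he : IsHomogeneousDer θ e) :
    ∃ φ ∈ A.logDer, IsNonEuler φ ∧ IsHomogeneousDer φ A.r := by
  rw [r_eq_sInf hA]
  exact Nat.sInf_mem (s := {e : ℕ | ∃ θ ∈ A.logDer, IsNonEuler θ ∧ IsHomogeneousDer θ e})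
    ⟨e, θ, hθ, hne, he⟩

lemma IsNonEuler.smul {θ : Der K ℓ} (h : IsNonEuler θ) {f : MvPolynomial (Fin ℓ) K}
    (hf : Prime f) (hX : ∃ i, ¬ f ∣ X i) : IsNonEuler (f • θ) := by
  intro g hg
  obtain ⟨i, hi⟩ := hX
  have hi' : f * θ (X i) = g * X i := by simpa using congrArg (fun φ : Der K ℓ => φ (X i)) hg
  obtain ⟨k, rfl⟩ := (hf.dvd_or_dvd (hi' ▸ dvd_mul_right f (θ (X i)))).resolve_right hi
  refine h k (derivation_ext fun j => mul_left_cancel₀ hf.ne_zero ?_)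
  simpa [mul_assoc] using congrArg (fun φ : Der K ℓ => φ (X j)) hg

/-- A linear form dividing every variable would make all variables proportional, impossible for ℓ ≥
2. For ℓ = 1 the claim fails: x ∂ is the Euler derivation. -/
lemma IsNonEuler.definingPoly_smul (hℓ : 2 ≤ ℓ) {θ : Der K ℓ} (h : IsNonEuler θ)
    (hH : H ∈ A.hyperplanes) : IsNonEuler (definingPoly H • θ) := by
  refine h.smul (prime_definingPoly hH) ?_
  by_contra! hX
  have key : ∀ i, ∃ c : K, X i = C c * definingPoly H := fun i =>
    (isHomogeneous_definingPoly H).exists_eq_C_mul_of_dvd (isHomogeneous_X K i)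
      (prime_definingPoly hH).ne_zero (hX i)
  obtain ⟨c, hc⟩ := key ⟨0, by omega⟩
  obtain ⟨d, hd⟩ := key ⟨1, by omega⟩
  have h1 : C d * X ⟨0, by omega⟩ = (C c * X ⟨1, by omega⟩ : MvPolynomial (Fin ℓ) K) := by
    rw [hc, hd]; ring
  have h2 := congrArg (coeff (Finsupp.single ⟨0, by omega⟩ 1)) h1
  have hne : (⟨1, by omega⟩ : Fin ℓ) ≠ ⟨0, by omega⟩ := by simp
  rw [coeff_C_mul, coeff_C_mul, coeff_X, coeff_X,
    if_pos rfl, if_neg (fun h => hne ((Finsupp.single_left_inj one_ne_zero).1 h))] at h2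
  have hd0 : d = 0 := by simpa using h2
  rw [hd0] at hd
  simp at hd

end HyperplaneArrangement

/-! ### Coefficient determinants and Saito's criterion -/

namespace HyperplaneArrangement

variable {K : Type*} [Field K] {ℓ : ℕ} {A : HyperplaneArrangement K ℓ}
  {H L : Submodule K (Fin ℓ → K)}

/-- The matrix of coefficients of a family of derivations. -/
def coeffMatrix (θ : Fin ℓ → Der K ℓ) : Matrix (Fin ℓ) (Fin ℓ) (MvPolynomial (Fin ℓ) K) :=
  Matrix.of fun i j => θ i (X j)

lemma coeffMatrix_apply (θ : Fin ℓ → Der K ℓ) (i j : Fin ℓ) :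
    coeffMatrix θ i j = θ i (X j) := rfl

/-- The matrix sends the coefficient vector of `a` to the values θ_i(a). Applying the adjugate, f
divides det · a_j, where a_j is a nonzero constant. -/
lemma dvd_det_coeffMatrix {θ : Fin ℓ → Der K ℓ} {a : Module.Dual K (Fin ℓ → K)} (ha : a ≠ 0)
    {f : MvPolynomial (Fin ℓ) K} (h : ∀ i, f ∣ θ i (linearPoly a)) :
    f ∣ (coeffMatrix θ).det := by
  obtain ⟨j, hj⟩ := exists_apply_single_ne_zero ha
  set v : Fin ℓ → MvPolynomial (Fin ℓ) K := fun k => C (a (Pi.single k 1)) with hv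
  have hMv : ∀ i, ((coeffMatrix θ).mulVec v) i = θ i (linearPoly a) := by
    intro i
    simp [Matrix.mulVec, dotProduct, coeffMatrix_apply, der_linearPoly, hv, mul_comm]
  have key := congrFun (congrArg (fun N => N.mulVec v)
    (Matrix.adjugate_mul (coeffMatrix θ))) j
  simp only [← Matrix.mulVec_mulVec, Matrix.smul_mulVec, Matrix.one_mulVec, Pi.smul_apply,
    smul_eq_mul] at key
  have hd : f ∣ (coeffMatrix θ).det * v j := by
    rw [← key, Matrix.mulVec, dotProduct]
    refine Finset.dvd_sum fun k _ => ?_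
    rw [hMv]
    exact (h k).mul_left _
  exact (((isUnit_iff_ne_zero.2 hj).map C).dvd_mul_right).1 hd

lemma definingPoly_dvd_det {θ : Fin ℓ → Der K ℓ} (hH : H ∈ A.hyperplanes)
    (h : ∀ i, definingPoly H ∣ θ i (definingPoly H)) :
    definingPoly H ∣ (coeffMatrix θ).det := by
  obtain ⟨a, ha, -, hp⟩ := exists_definingPoly_eq (A.isHyperplane H hH)
  rw [hp] at h ⊢
  exact dvd_det_coeffMatrix ha h

lemma Q_dvd_det {θ : Fin ℓ → Der K ℓ} (h : ∀ i, θ i ∈ A.logDer) :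
    A.Q ∣ (coeffMatrix θ).det :=
  Q_dvd fun H hH => definingPoly_dvd_det hH fun i => mem_logDer.1 (h i) H hH

lemma isHomogeneous_det_coeffMatrix {θ : Fin ℓ → Der K ℓ} {d : Fin ℓ → ℕ}
    (h : ∀ i, IsHomogeneousDer (θ i) (d i)) :
    (coeffMatrix θ).det.IsHomogeneous (∑ i, d i) := by
  rw [← Matrix.det_transpose, Matrix.det_apply']
  refine IsHomogeneous.sum _ _ _ fun σ _ => ?_
  have h1 : (∏ i, (coeffMatrix θ).transpose (σ i) i).IsHomogeneous (∑ i, d i) :=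
    IsHomogeneous.prod _ _ _ fun i _ => isHomogeneousDer_iff.1 (h i) (σ i)
  have h2 := h1.C_mul (((Equiv.Perm.sign σ : ℤˣ) : ℤ) : K)
  rwa [map_intCast] at h2

lemma det_basis_dvd_det (b : Module.Basis (Fin ℓ) (MvPolynomial (Fin ℓ) K) A.logDer)
    {φ : Fin ℓ → Der K ℓ} (h : ∀ i, φ i ∈ A.logDer) :
    (coeffMatrix fun i => (b i : Der K ℓ)).det ∣ (coeffMatrix φ).det := by
  have : coeffMatrix φ =
      (Matrix.of fun i k => b.repr ⟨φ i, h i⟩ k) * coeffMatrix fun i => (b i : Der K ℓ) := by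
    ext1 i j
    have hs := congrArg (fun θ : A.logDer => (θ : Der K ℓ) (X j)) (b.sum_repr ⟨φ i, h i⟩)
    simp only [AddSubmonoidClass.coe_finsetSum, der_sum_apply, Submodule.coe_smul,
      Derivation.smul_apply, smul_eq_mul] at hs
    rw [Matrix.mul_apply, coeffMatrix_apply, ← hs]
    rfl
  rw [this, Matrix.det_mul]
  exact dvd_mul_left _ _

/-- Test derivations for Saito's criterion: α_L occurs only once in their determinant, so an excess
factor in the determinant of a basis must come from the other hyperplanes. -/
lemma exists_mem_logDer_det_eq {A : HyperplaneArrangement K 3} {L : Submodule K (Fin 3 → K)}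
    (hL : L ∈ A.hyperplanes) :
    ∃ φ : Fin 3 → Der K 3, (∀ i, φ i ∈ A.logDer) ∧
      ∃ c : K, c ≠ 0 ∧ (coeffMatrix φ).det = C c * (A.deletion L).Q ^ 3 * definingPoly L := by
  obtain ⟨a, ha, -, hp⟩ := exists_definingPoly_eq (A.isHyperplane L hL)
  obtain ⟨j, hj⟩ := exists_apply_single_ne_zero ha
  -- For i ≠ j the row is a_j ∂_i − a_i ∂_j, which kills α_L; for i = j those terms cancel and α_L
  -- ∂_j remains. The factor Q(A ∖ {L}) takes care of the other hyperplanes.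
  set N : Fin 3 → Fin 3 → MvPolynomial (Fin 3) K := fun i k =>
    C (a (Pi.single j 1)) * (if k = i then 1 else 0) - C (a (Pi.single i 1)) *
      (if k = j then 1 else 0) + definingPoly L * (if i = j ∧ k = j then 1 else 0) with hN
  refine ⟨fun i => (A.deletion L).Q • mkDerivation K (N i), fun i => ?_, a (Pi.single j 1) ^ 2,
    pow_ne_zero 2 hj, ?_⟩
  · rw [mem_logDer]
    intro M hM
    rw [Derivation.smul_apply, smul_eq_mul]
    by_cases hML : M = L
    · subst hML
      refine Dvd.dvd.mul_left ?_ _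
      conv_rhs => rw [hp]
      rw [der_linearPoly]
      simp only [mkDerivation_X, hN, mul_add, mul_sub, Finset.sum_add_distrib,
        Finset.sum_sub_distrib]
      refine dvd_add ?_ (Finset.dvd_sum fun k _ => (dvd_mul_right _ _).mul_left _)
      simp [mul_comm]
    · exact (definingPoly_dvd_Q (A := A.deletion L) (mem_deletion.2 ⟨hML, hM⟩)).mul_right _
  · have : coeffMatrix (fun i => (A.deletion L).Q • mkDerivation K (N i)) =
        (A.deletion L).Q • Matrix.of N := by
      ext1 i k
      simp [coeffMatrix_apply]
    rw [this, Matrix.det_smul, Matrix.det_fin_three, Fintype.card_fin]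
    fin_cases j <;> simp [hN] <;> ring

/-- Saito's criterion: the coefficient matrix of a basis of `D(A)` has determinant `Q(A)`, up to
a nonzero constant. -/
lemma exists_det_basis_eq {A : HyperplaneArrangement K 3} (hA : A.hyperplanes.Nonempty)
    (b : Module.Basis (Fin 3) (MvPolynomial (Fin 3) K) A.logDer) :
    ∃ c : K, c ≠ 0 ∧ (coeffMatrix fun i => (b i : Der K 3)).det = C c * A.Q := by
  obtain ⟨u, hu⟩ := Q_dvd_det fun i => (b i).2
  -- Cancelling Q(A) in the comparison with the test derivations leaves u ∣ c Q(A ∖ {L})².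
  have key : ∀ L ∈ A.hyperplanes, ∀ p, Prime p → p ∣ u → p ∣ (A.deletion L).Q := by
    intro L hL p hp hpu
    obtain ⟨φ, hφ, c, hc, hdet⟩ := exists_mem_logDer_det_eq hL
    have h1 := det_basis_dvd_det b hφ
    rw [hdet, hu, Q_deletion hL] at h1
    have h2 : (definingPoly L * (A.deletion L).Q) * u ∣
        (definingPoly L * (A.deletion L).Q) * (C c * (A.deletion L).Q ^ 2) := by
      convert h1 using 1; ring
    have h3 := (mul_dvd_mul_iff_left
      (mul_ne_zero (prime_definingPoly hL).ne_zero Q_ne_zero)).1 h2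
    have h4 := (((isUnit_iff_ne_zero.2 hc).map (C : K →+* MvPolynomial (Fin 3) K)).dvd_mul_left).1
      (hpu.trans h3)
    exact hp.dvd_of_dvd_pow h4
  have hu0 : u ≠ 0 := by
    rintro rfl
    obtain ⟨L, hL⟩ := hA
    obtain ⟨φ, hφ, c, hc, hdet⟩ := exists_mem_logDer_det_eq hL
    have h1 := det_basis_dvd_det b hφ
    rw [hu, mul_zero, zero_dvd_iff, hdet] at h1
    simp [hc, Q_ne_zero, (prime_definingPoly hL).ne_zero] at h1
  have hunit : IsUnit u := by
    by_contra hnu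
    obtain ⟨p, hp, hpu⟩ := WfDvdMonoid.exists_irreducible_factor hnu hu0
    have hp' := hp.prime
    obtain ⟨L, hL⟩ := hA
    -- The prime p is associated to some α_M; applying `key` to M itself gives α_M ∣ Q(A ∖ {M}), a
    -- contradiction.
    obtain ⟨M, hM, hpM⟩ := (hp'.dvd_finsetProd_iff _).1 (key L hL p hp' hpu)
    rw [mem_deletion] at hM
    have has := (hp.dvd_irreducible_iff_associated (prime_definingPoly hM.2).irreducible).1 hpM
    exact not_definingPoly_dvd_Q_deletion hM.2 (has.symm.dvd.trans (key M hM.2 p hp' hpu))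
  obtain ⟨c, hc, rfl⟩ := (isUnit_iff_eq_C_of_isReduced).1 hunit
  exact ⟨c, hc.ne_zero, by rw [hu, mul_comm]⟩

/-- Taking degree e parts of a given expression for θ, only the component of degree e − d i of the
i-th coefficient contributes, and none if e < d i. -/
lemma exists_homogeneous_coeff {ι : Type*} [Fintype ι] {θ : Der K ℓ} {e : ℕ}
    (hθ : IsHomogeneousDer θ e) {b : ι → Der K ℓ} {d : ι → ℕ}
    (hb : ∀ i, IsHomogeneousDer (b i) (d i)) (h : θ ∈ Submodule.span (MvPolynomial (Fin ℓ) K) (Set.range b)) :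
    ∃ f : ι → MvPolynomial (Fin ℓ) K, θ = ∑ i, f i • b i ∧
      ∀ i, (d i ≤ e → (f i).IsHomogeneous (e - d i)) ∧ (e < d i → f i = 0) := by
  obtain ⟨g, hg⟩ := (Submodule.mem_span_range_iff_exists_fun _).1 h
  refine ⟨fun i => if d i ≤ e then homogeneousComponent (e - d i) (g i) else 0, ?_, fun i =>
    ⟨fun hi => by simpa [hi] using homogeneousComponent_isHomogeneous _ _,
     fun hi => by simp [hi]⟩⟩
  refine derivation_ext fun j => ?_
  rw [← homogeneousComponent_eq_self (isHomogeneousDer_iff.1 hθ j), ← hg]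
  simp only [der_sum_apply, map_sum, Derivation.smul_apply, smul_eq_mul]
  refine Finset.sum_congr rfl fun i _ => ?_
  rw [mul_comm, (isHomogeneousDer_iff.1 (hb i) j).homogeneousComponent_mul]
  split_ifs <;> ring

/-! ### Homogeneous bases containing the Euler derivation -/

/-- The determinant of the coefficients of the Euler derivation, `φ` and `ψ`. -/
def eulerDet (φ ψ : Der K 3) : MvPolynomial (Fin 3) K :=
  (coeffMatrix ![eulerDer K 3, φ, ψ]).det

lemma eulerDet_eq (φ ψ : Der K 3) : eulerDet φ ψ =
    X 0 * φ (X 1) * ψ (X 2) - X 0 * φ (X 2) * ψ (X 1) - X 1 * φ (X 0) * ψ (X 2) +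
      X 1 * φ (X 2) * ψ (X 0) + X 2 * φ (X 0) * ψ (X 1) - X 2 * φ (X 1) * ψ (X 0) := by
  rw [eulerDet, Matrix.det_fin_three]
  simp [coeffMatrix_apply]

lemma definingPoly_dvd_eulerDet {A : HyperplaneArrangement K 3} {H : Submodule K (Fin 3 → K)}
    (hH : H ∈ A.hyperplanes) {φ ψ : Der K 3}
    (hφ : definingPoly H ∣ φ (definingPoly H)) (hψ : definingPoly H ∣ ψ (definingPoly H)) :
    definingPoly H ∣ eulerDet φ ψ :=
  definingPoly_dvd_det hH fun i => by
    fin_cases i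
    · simp [eulerDer_apply (isHomogeneous_definingPoly H)]
    · exact hφ
    · exact hψ

lemma isHomogeneous_eulerDet {φ ψ : Der K 3} {d e : ℕ} (hφ : IsHomogeneousDer φ d)
    (hψ : IsHomogeneousDer ψ e) : (eulerDet φ ψ).IsHomogeneous (1 + d + e) := by
  have := isHomogeneous_det_coeffMatrix (θ := ![eulerDer K 3, φ, ψ]) (d := ![1, d, e]) (by
    intro i
    fin_cases i
    exacts [isHomogeneousDer_eulerDer, hφ, hψ])
  rw [Fin.sum_univ_three] at this
  exact this

/-- Homogeneous `θ₂`, `θ₃` of degrees `d₂`, `d₃` that form a basis of `D(A)` together with the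
Euler derivation, with the consequences of this on determinants and coefficients. -/
structure IsSaitoPair (A : HyperplaneArrangement K 3) (d₂ d₃ : ℕ) (θ₂ θ₃ : Der K 3) : Prop where
  mem₂ : θ₂ ∈ A.logDer
  mem₃ : θ₃ ∈ A.logDer
  hom₂ : IsHomogeneousDer θ₂ d₂
  hom₃ : IsHomogeneousDer θ₃ d₃
  det : ∃ c : K, c ≠ 0 ∧ eulerDet θ₂ θ₃ = C c * A.Q
  coeff : ∀ {θ : Der K 3} {e : ℕ}, θ ∈ A.logDer → IsHomogeneousDer θ e →
    ∃ f g k : MvPolynomial (Fin 3) K, θ = f • eulerDer K 3 + g • θ₂ + k • θ₃ ∧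
      (d₂ ≤ e → g.IsHomogeneous (e - d₂)) ∧ (e < d₂ → g = 0) ∧
      (d₃ ≤ e → k.IsHomogeneous (e - d₃)) ∧ (e < d₃ → k = 0)

lemma IsFreeWithExponents.exists_isSaitoPair {A : HyperplaneArrangement K 3}
    (hA : A.hyperplanes.Nonempty) {d₂ d₃ : ℕ} (h : A.IsFreeWithExponents ![1, d₂, d₃]) :
    ∃ θ₂ θ₃, A.IsSaitoPair d₂ d₃ θ₂ θ₃ := by
  obtain ⟨b, hb0, hb⟩ := h
  refine ⟨b 1, b 2, (b 1).2, (b 2).2, hb 1, hb 2, ?_, ?_⟩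
  · obtain ⟨c, hc, hdet⟩ := exists_det_basis_eq hA b
    refine ⟨c, hc, ?_⟩
    rw [← hdet, eulerDet]
    congr 2
    ext1 i
    fin_cases i
    exacts [hb0.symm, rfl, rfl]
  · intro θ e hθ he
    obtain ⟨f, hf, hfh⟩ := exists_homogeneous_coeff he hb (by
      refine (Submodule.mem_span_range_iff_exists_fun _).2 ⟨b.repr ⟨θ, hθ⟩, ?_⟩
      have := congrArg (fun φ : A.logDer => (φ : Der K 3)) (b.sum_repr ⟨θ, hθ⟩)
      rwa [AddSubmonoidClass.coe_finsetSum] at this)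
    refine ⟨f 0, f 1, f 2, ?_, (hfh 1).1, (hfh 1).2, (hfh 2).1, (hfh 2).2⟩
    rw [hf, Fin.sum_univ_three, hb0]

namespace IsSaitoPair

variable {A : HyperplaneArrangement K 3} {d₂ d₃ : ℕ} {θ₂ θ₃ : Der K 3}

lemma eulerDet_ne_zero (h : A.IsSaitoPair d₂ d₃ θ₂ θ₃) : eulerDet θ₂ θ₃ ≠ 0 := by
  obtain ⟨c, hc, hdet⟩ := h.det
  rw [hdet]
  exact mul_ne_zero (by simpa using hc) Q_ne_zero

lemma card_eq (h : A.IsSaitoPair d₂ d₃ θ₂ θ₃) : A.hyperplanes.card = 1 + d₂ + d₃ := by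
  have h1 := isHomogeneous_eulerDet h.hom₂ h.hom₃
  have h0 := h.eulerDet_ne_zero
  obtain ⟨c, hc, hdet⟩ := h.det
  rw [hdet] at h1 h0
  exact ((isHomogeneous_Q A).C_mul c).inj_right h1 h0

lemma isNonEuler_smul_add_smul (h : A.IsSaitoPair d₂ d₃ θ₂ θ₃) {g k : MvPolynomial (Fin 3) K}
    (hgk : g ≠ 0 ∨ k ≠ 0) : IsNonEuler (g • θ₂ + k • θ₃) := by
  intro f hf
  have hX : ∀ i, g * θ₂ (X i) + k * θ₃ (X i) = f * X i := fun i => by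
    simpa using congrArg (fun φ : Der K 3 => φ (X i)) hf
  rcases hgk with h0 | h0
  · refine mul_ne_zero h0 h.eulerDet_ne_zero ?_
    rw [eulerDet_eq]
    linear_combination (X 2 * θ₃ (X 1) - X 1 * θ₃ (X 2)) * hX 0 +
      (X 0 * θ₃ (X 2) - X 2 * θ₃ (X 0)) * hX 1 + (X 1 * θ₃ (X 0) - X 0 * θ₃ (X 1)) * hX 2
  · refine mul_ne_zero h0 h.eulerDet_ne_zero ?_
    rw [eulerDet_eq]
    linear_combination (X 1 * θ₂ (X 2) - X 2 * θ₂ (X 1)) * hX 0 +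
      (X 2 * θ₂ (X 0) - X 0 * θ₂ (X 2)) * hX 1 + (X 0 * θ₂ (X 1) - X 1 * θ₂ (X 0)) * hX 2

lemma isNonEuler₂ (h : A.IsSaitoPair d₂ d₃ θ₂ θ₃) : IsNonEuler θ₂ := by
  simpa using h.isNonEuler_smul_add_smul (g := 1) (k := 0) (Or.inl one_ne_zero)

lemma le_of_isNonEuler (h : A.IsSaitoPair d₂ d₃ θ₂ θ₃) (hd : d₂ ≤ d₃) {θ : Der K 3} {e : ℕ}
    (hθ : θ ∈ A.logDer) (hne : IsNonEuler θ) (he : IsHomogeneousDer θ e) : d₂ ≤ e := by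
  by_contra! hlt
  obtain ⟨f, g, k, heq, -, hg, -, hk⟩ := h.coeff hθ he
  rw [hg hlt, hk (by omega)] at heq
  exact hne f (by simpa using heq)

/-- A homogeneous element of degree `d₂` of `D(A)` that is not a multiple of the Euler derivation
can take the place of `θ₂`. -/
lemma exists_eulerDet_eq (h : A.IsSaitoPair d₂ d₃ θ₂ θ₃) (hd : d₂ ≤ d₃) {θ : Der K 3}
    (hθ : θ ∈ A.logDer) (hne : IsNonEuler θ) (he : IsHomogeneousDer θ d₂) :
    ∃ φ ∈ A.logDer, IsHomogeneousDer φ d₃ ∧ ∃ c : K, c ≠ 0 ∧ eulerDet θ φ = C c * A.Q := by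
  obtain ⟨f, g, k, heq, hg, -, hk, hk'⟩ := h.coeff hθ he
  obtain ⟨c, hc, hdet⟩ := h.det
  have hX : ∀ i, θ (X i) = f * X i + g * θ₂ (X i) + k * θ₃ (X i) := fun i => by
    simp [heq]
  obtain ⟨g', rfl⟩ : ∃ g', g = C g' := by
    have := hg le_rfl
    rw [Nat.sub_self] at this
    exact this.eq_C
  -- If θ₂ occurs in θ, then θ₃ is the complement. Otherwise θ₃ occurs, which forces d₂ = d₃, and θ₂
  -- is the complement.
  by_cases hg0 : g' = 0
  · subst hg0
    have hk0 : k ≠ 0 := by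
      rintro rfl
      exact hne f (by simpa using heq)
    have hdd : d₂ = d₃ := by
      by_contra hdd
      exact hk0 (hk' (by omega))
    subst hdd
    obtain ⟨k', rfl⟩ : ∃ k', k = C k' := by
      have := hk le_rfl
      rw [Nat.sub_self] at this
      exact this.eq_C
    refine ⟨θ₂, h.mem₂, h.hom₂, -k' * c, mul_ne_zero (neg_ne_zero.2 (by simpa using hk0)) hc, ?_⟩
    rw [C_mul, mul_assoc, ← hdet, eulerDet_eq, eulerDet_eq, hX, hX, hX, C_0, C_neg]
    ring
  · refine ⟨θ₃, h.mem₃, h.hom₃, g' * c, mul_ne_zero hg0 hc, ?_⟩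
    rw [C_mul, mul_assoc, ← hdet, eulerDet_eq, eulerDet_eq, hX, hX, hX]
    ring

end IsSaitoPair

end HyperplaneArrangement

/-! ### Reduction modulo α_H -/

namespace HyperplaneArrangement

variable {K : Type*} [Field K] {ℓ : ℕ} {A : HyperplaneArrangement K ℓ}
  {H L M : Submodule K (Fin ℓ → K)} {a : Module.Dual K (Fin ℓ → K)} {j : Fin ℓ}

lemma elim_definingPoly_ne_zero (hH : H ∈ A.hyperplanes) (hp : definingPoly H = linearPoly a)
    (hj : a (Pi.single j 1) ≠ 0) (hL : L ∈ A.hyperplanes) (hLH : L ≠ H) :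
    elim a j (definingPoly L) ≠ 0 := by
  rw [Ne, elim_eq_zero_iff hj, ← hp]
  exact fun h => hLH (eq_of_definingPoly_dvd hH hL h).symm

lemma prime_elim_definingPoly (hH : H ∈ A.hyperplanes) (hp : definingPoly H = linearPoly a)
    (hj : a (Pi.single j 1) ≠ 0) (hL : L ∈ A.hyperplanes) (hLH : L ≠ H) :
    Prime (elim a j (definingPoly L)) := by
  have h0 := elim_definingPoly_ne_zero hH hp hj hL hLH
  obtain ⟨b, -, -, hb⟩ := exists_definingPoly_eq (A.isHyperplane L hL)
  rw [hb, elim_linearPoly_eq] at h0 ⊢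
  refine prime_linearPoly fun h => h0 ?_
  rw [h]
  exact map_zero (linearPolyHom K ℓ)

lemma inf_eq_inf_of_elim_dvd (hH : H ∈ A.hyperplanes) (hp : definingPoly H = linearPoly a)
    (ha : LinearMap.ker a = H) (hj : a (Pi.single j 1) ≠ 0)
    (hL : L ∈ A.hyperplanes) (hLH : L ≠ H) (hM : M ∈ A.hyperplanes) (hMH : M ≠ H)
    (h : elim a j (definingPoly L) ∣ elim a j (definingPoly M)) : H ⊓ L = H ⊓ M := by
  have h0 := elim_definingPoly_ne_zero hH hp hj hL hLH
  have h1 := elim_definingPoly_ne_zero hH hp hj hM hMH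
  obtain ⟨b, -, rfl, hb⟩ := exists_definingPoly_eq (A.isHyperplane L hL)
  obtain ⟨c, -, rfl, hc⟩ := exists_definingPoly_eq (A.isHyperplane M hM)
  rw [hb, elim_linearPoly_eq] at h0 h
  rw [hc, elim_linearPoly_eq] at h1 h
  have h0' : b - (b (Pi.single j 1) * (a (Pi.single j 1))⁻¹) • a ≠ 0 := by
    intro h'
    exact h0 (by rw [h']; exact map_zero (linearPolyHom K ℓ))
  obtain ⟨t, ht⟩ := exists_smul_of_linearPoly_dvd h0' h
  have ht0 : t ≠ 0 := by
    rintro rfl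
    rw [ht, zero_smul] at h1
    exact h1 (map_zero (linearPolyHom K ℓ))
  rw [← ha]
  ext x
  simp only [Submodule.mem_inf, LinearMap.mem_ker]
  refine and_congr_right fun hx => ?_
  have := LinearMap.congr_fun ht x
  simp only [LinearMap.sub_apply, LinearMap.smul_apply, hx, smul_eq_mul, mul_zero,
    sub_zero] at this
  simp [this, ht0]

/-- α_M vanishes on H ∩ L, hence lies in the span of α_H and α_L; the coefficient of α_L is nonzero
because M ≠ H. -/
lemma exists_definingPoly_eq_of_inf_eq_inf (hH : H ∈ A.hyperplanes)
    (hL : L ∈ A.hyperplanes) (hM : M ∈ A.hyperplanes) (hMH : M ≠ H) (h : H ⊓ L = H ⊓ M) :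
    ∃ s t : K, t ≠ 0 ∧ definingPoly M = C s * definingPoly H + C t * definingPoly L := by
  obtain ⟨a, -, ha, hpa⟩ := exists_definingPoly_eq (A.isHyperplane H hH)
  obtain ⟨b, -, hb, hpb⟩ := exists_definingPoly_eq (A.isHyperplane L hL)
  obtain ⟨c, -, hc, hpc⟩ := exists_definingPoly_eq (A.isHyperplane M hM)
  have hspan : c ∈ Submodule.span K (Set.range ![a, b]) := by
    refine mem_span_of_iInf_ker_le_ker ?_
    intro x hx
    simp only [Submodule.mem_iInf, Fin.forall_fin_two, Matrix.cons_val_zero,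
      Matrix.cons_val_one] at hx
    have : x ∈ H ⊓ L := ⟨ha ▸ hx.1, hb ▸ hx.2⟩
    rw [h] at this
    rw [hc]
    exact this.2
  obtain ⟨f, hf⟩ := (Submodule.mem_span_range_iff_exists_fun K).1 hspan
  simp only [Fin.sum_univ_two, Matrix.cons_val_zero, Matrix.cons_val_one] at hf
  have heq : definingPoly M = C (f 0) * definingPoly H + C (f 1) * definingPoly L := by
    rw [hpa, hpb, hpc, ← hf, linearPoly_add, linearPoly_smul, linearPoly_smul]
  refine ⟨f 0, f 1, fun h0 => hMH ?_, heq⟩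
  rw [h0, C_0, zero_mul, add_zero] at heq
  exact (eq_of_definingPoly_dvd hH hM (heq ▸ dvd_mul_left _ _)).symm

lemma mem_restriction {Y : Submodule K (Fin ℓ → K)} :
    Y ∈ A.restriction H ↔ ∃ L, L ≠ H ∧ L ∈ A.hyperplanes ∧ H ⊓ L = Y := by
  classical
  simp [restriction, and_assoc]

/-- Data for working modulo `α_H`: an algebra map `p` with kernel `(α_H)`, the product `R` of the
images of one form `α_L` for each element of `A^H`, and the product `N` of the images of all `α_L`
with `L ∈ A ∖ {H}`. -/
structure IsReduction (A : HyperplaneArrangement K 3) (H : Submodule K (Fin 3 → K))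
    (p : MvPolynomial (Fin 3) K →ₐ[K] MvPolynomial (Fin 3) K) (i k : Fin 3)
    (R N : MvPolynomial (Fin 3) K) : Prop where
  eq_zero_iff : ∀ f, p f = 0 ↔ definingPoly H ∣ f
  hom : ∀ {f : MvPolynomial (Fin 3) K} {n : ℕ}, f.IsHomogeneous n → (p f).IsHomogeneous n
  R_ne_zero : R ≠ 0
  R_hom : R.IsHomogeneous (A.restriction H).card
  N_ne_zero : N ≠ 0
  N_hom : N.IsHomogeneous (A.deletion H).hyperplanes.card
  R_dvd : ∀ {θ : Der K 3}, θ ∈ A.logDer → R ∣ p (θ (X i)) * X k - p (θ (X k)) * X i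
  N_dvd : ∀ {θ : Der K 3}, θ ∈ (A.deletion H).logDer → N ∣ p (θ (definingPoly H)) * R
  exists_eq : ∀ {θ : Der K 3} {e : ℕ}, θ ∈ A.logDer → IsHomogeneousDer θ e → IsNonEuler θ →
    p (θ (X i)) * X k = p (θ (X k)) * X i →
      ∃ (g : MvPolynomial (Fin 3) K) (φ : Der K 3) (d : ℕ), e = d + 1 ∧ IsHomogeneousDer φ d ∧
        θ = g • eulerDer K 3 + definingPoly H • φ

lemma sum_fin_three_eq {M : Type*} [AddCommMonoid M] (f : Fin 3 → M) (j : Fin 3) :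
    ∑ i, f i = f j + f (j + 1) + f (j + 2) := by
  rw [Fin.sum_univ_three]
  fin_cases j
  · rfl
  · change _ = f 1 + f 2 + f 0
    abel
  · change _ = f 2 + f 0 + f 1
    abel

variable {A : HyperplaneArrangement K 3} {H L : Submodule K (Fin 3 → K)}
  {a : Module.Dual K (Fin 3 → K)} {j : Fin 3}

/-- On H, with coordinates X (j + 1) and X (j + 2), this is the plane case of Saito's divisibility:
the minor is, up to sign, the determinant of θ_E and the restricted θ, both of which preserve the
restricted α_L. -/
lemma elim_definingPoly_dvd_minor (hH : H ∈ A.hyperplanes) (hp : definingPoly H = linearPoly a)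
    (hj : a (Pi.single j 1) ≠ 0) (hL : L ∈ A.hyperplanes) (hLH : L ≠ H) {θ : Der K 3}
    (hθ : θ ∈ A.logDer) :
    elim a j (definingPoly L) ∣
      elim a j (θ (X (j + 1))) * X (j + 2) - elim a j (θ (X (j + 2))) * X (j + 1) := by
  have h0 := elim_definingPoly_ne_zero hH hp hj hL hLH
  obtain ⟨b, -, -, hb⟩ := exists_definingPoly_eq (A.isHyperplane L hL)
  set b' := b - (b (Pi.single j 1) * (a (Pi.single j 1))⁻¹) • a with hb'
  have hbj : b' (Pi.single j 1) = 0 := by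
    simp [hb', hj]
  have hlin : elim a j (definingPoly L) = C (b' (Pi.single (j + 1) 1)) * X (j + 1) +
      C (b' (Pi.single (j + 2) 1)) * X (j + 2) := by
    rw [hb, elim_linearPoly_eq, ← hb', linearPoly, sum_fin_three_eq _ j, hbj]
    simp
  have hder : elim a j (θ (definingPoly L)) =
      C (b' (Pi.single (j + 1) 1)) * elim a j (θ (X (j + 1))) +
        C (b' (Pi.single (j + 2) 1)) * elim a j (θ (X (j + 2))) := by
    have h1 : linearPoly b = linearPoly b' +
        C (b (Pi.single j 1) * (a (Pi.single j 1))⁻¹) * linearPoly a := by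
      rw [hb', linearPoly_sub, linearPoly_smul]; ring
    have h2 : elim a j (θ (linearPoly a)) = 0 := by
      rw [elim_eq_zero_iff hj, ← hp]
      exact mem_logDer.1 hθ H hH
    rw [hb, h1, map_add, der_C_mul, map_add, map_mul, h2, mul_zero,
      add_zero, der_linearPoly, sum_fin_three_eq _ j, hbj]
    simp
  have hdvd : elim a j (definingPoly L) ∣ elim a j (θ (definingPoly L)) :=
    map_dvd _ (mem_logDer.1 hθ L hL)
  set u := b' (Pi.single (j + 1) 1)
  set v := b' (Pi.single (j + 2) 1)
  set W := elim a j (θ (X (j + 1))) * X (j + 2) - elim a j (θ (X (j + 2))) * X (j + 1) with hW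
  have hu : elim a j (definingPoly L) ∣ C u * W := by
    have : C u * W = X (j + 2) * elim a j (θ (definingPoly L)) -
        elim a j (θ (X (j + 2))) * elim a j (definingPoly L) := by
      rw [hder, hlin, hW]; ring
    rw [this]
    exact dvd_sub (hdvd.mul_left _) (dvd_mul_left _ _)
  have hv : elim a j (definingPoly L) ∣ C v * W := by
    have : C v * W = elim a j (θ (X (j + 1))) * elim a j (definingPoly L) -
        X (j + 1) * elim a j (θ (definingPoly L)) := by
      rw [hder, hlin, hW]; ring
    rw [this]
    exact dvd_sub (dvd_mul_left _ _) (hdvd.mul_left _)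
  by_cases hu0 : u = 0
  · have hv0 : v ≠ 0 := by
      rintro hv0
      rw [hlin, hu0, hv0] at h0
      simp at h0
    exact (((isUnit_iff_ne_zero.2 hv0).map
      (C : K →+* MvPolynomial (Fin 3) K)).dvd_mul_left).1 hv
  · exact (((isUnit_iff_ne_zero.2 hu0).map
      (C : K →+* MvPolynomial (Fin 3) K)).dvd_mul_left).1 hu

/-- A vanishing minor makes θ proportional to θ_E on H, with a polynomial factor g since the two
variables are coprime. The X j coordinate of θ − g θ_E is also divisible by α_H, because θ preserves
α_H and a_j ≠ 0. -/
lemma exists_eq_smul_eulerDer_add (hp : definingPoly H = linearPoly a)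
    (hH : H ∈ A.hyperplanes) (hj : a (Pi.single j 1) ≠ 0) {θ : Der K 3} {e : ℕ}
    (hθ : θ ∈ A.logDer) (he : IsHomogeneousDer θ e) (hne : IsNonEuler θ)
    (hW : elim a j (θ (X (j + 1))) * X (j + 2) = elim a j (θ (X (j + 2))) * X (j + 1)) :
    ∃ (g : MvPolynomial (Fin 3) K) (φ : Der K 3) (d : ℕ), e = d + 1 ∧ IsHomogeneousDer φ d ∧
      θ = g • eulerDer K 3 + definingPoly H • φ := by
  have hne12 : j + 1 ≠ j + 2 := by simp
  obtain ⟨g, hg⟩ : (X (j + 1) : MvPolynomial (Fin 3) K) ∣ elim a j (θ (X (j + 1))) := by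
    have h1 : (X (j + 1) : MvPolynomial (Fin 3) K) ∣ elim a j (θ (X (j + 1))) * X (j + 2) :=
      hW ▸ dvd_mul_left _ _
    exact (X_dvd_mul_iff.1 h1).resolve_right fun h => hne12 (X_dvd_X.1 h)
  have hg2 : elim a j (θ (X (j + 2))) = X (j + 2) * g := by
    refine mul_right_cancel₀ (X_ne_zero (j + 1)) ?_
    rw [← hW, hg]; ring
  have h1 : linearPoly a ∣ θ (X (j + 1)) - g * X (j + 1) := by
    rw [mul_comm, ← hg]; exact dvd_sub_elim _ _ _
  have h2 : linearPoly a ∣ θ (X (j + 2)) - g * X (j + 2) := by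
    rw [mul_comm, ← hg2]; exact dvd_sub_elim _ _ _
  have h0 : linearPoly a ∣ θ (X j) - g * X j := by
    have h3 : linearPoly a ∣ θ (linearPoly a) - g * linearPoly a :=
      dvd_sub (by rw [← hp]; exact mem_logDer.1 hθ H hH) (dvd_mul_left _ _)
    have h4 : C (a (Pi.single j 1)) * (θ (X j) - g * X j) =
        (θ (linearPoly a) - g * linearPoly a) -
          C (a (Pi.single (j + 1) 1)) * (θ (X (j + 1)) - g * X (j + 1)) -
          C (a (Pi.single (j + 2) 1)) * (θ (X (j + 2)) - g * X (j + 2)) := by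
      rw [der_linearPoly, linearPoly, sum_fin_three_eq _ j, sum_fin_three_eq _ j]; ring
    have h5 : linearPoly a ∣ C (a (Pi.single j 1)) * (θ (X j) - g * X j) := by
      rw [h4]
      exact dvd_sub (dvd_sub h3 (h1.mul_left _)) (h2.mul_left _)
    exact (((isUnit_iff_ne_zero.2 hj).map
      (C : K →+* MvPolynomial (Fin 3) K)).dvd_mul_left).1 h5
  have hall : ∀ i, linearPoly a ∣ θ (X i) - g * X i := by
    intro i
    obtain rfl | rfl | rfl : i = j ∨ i = j + 1 ∨ i = j + 2 := by
      clear * -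
      revert i j; decide
    exacts [h0, h1, h2]
  choose q hq using hall
  have hθq : θ = g • eulerDer K 3 + definingPoly H • mkDerivation K q := by
    refine derivation_ext fun i => ?_
    simp only [Derivation.add_apply, Derivation.smul_apply, eulerDer_X, mkDerivation_X,
      smul_eq_mul, hp, ← hq]
    ring
  have hgX : (X (j + 1) * g).IsHomogeneous e := by
    rw [← hg]; exact isHomogeneous_elim a j (isHomogeneousDer_iff.1 he _)
  have ha0 : linearPoly a ≠ 0 := hp ▸ (prime_definingPoly hH).ne_zero
  have hghom : ∀ i, (g * X i).IsHomogeneous e := by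
    intro i
    rcases e with _ | d
    · rw [(isHomogeneous_X K (j + 1)).eq_zero_of_mul_left (X_ne_zero _) hgX zero_lt_one, zero_mul]
      exact isHomogeneous_zero _ _ _
    · exact ((isHomogeneous_X K (j + 1)).of_mul_left (X_ne_zero _)
        ((add_comm d 1) ▸ hgX)).mul (isHomogeneous_X K i)
  have hqhom : ∀ i, (linearPoly a * q i).IsHomogeneous e := fun i => by
    rw [← hq]; exact (isHomogeneousDer_iff.1 he i).sub (hghom i)
  -- In degree 0 every q i vanishes, so θ would be a multiple of θ_E.
  rcases e with _ | d
  · refine absurd ?_ (hne g)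
    have : ∀ i, q i = 0 := fun i =>
      (isHomogeneous_linearPoly a).eq_zero_of_mul_left ha0 (hqhom i) zero_lt_one
    refine derivation_ext fun i => ?_
    have hi := hq i
    rw [this, mul_zero, sub_eq_zero] at hi
    simpa using hi
  · refine ⟨g, mkDerivation K q, d, rfl, isHomogeneousDer_iff.2 fun i => ?_, hθq⟩
    rw [mkDerivation_X]
    exact (isHomogeneous_linearPoly a).of_mul_left ha0 ((add_comm d 1) ▸ hqhom i)

/-- Every α_M in the fibre is a combination of α_H and α_L, so it divides θ(α_H) α_L − θ(α_L) α_H.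
The α_M are coprime before restriction, though proportional after it, so their product is formed
first and then reduced. -/
lemma prod_fiber_dvd (hH : H ∈ A.hyperplanes) (hp : definingPoly H = linearPoly a)
    (hj : a (Pi.single j 1) ≠ 0) (hL : L ∈ A.hyperplanes)
    {s : Finset (Submodule K (Fin 3 → K))} (hs : s ⊆ (A.deletion H).hyperplanes)
    (hsL : ∀ M ∈ s, H ⊓ L = H ⊓ M) {θ : Der K 3} (hθ : θ ∈ (A.deletion H).logDer) :
    ∏ M ∈ s, elim a j (definingPoly M) ∣
      elim a j (θ (definingPoly H)) * elim a j (definingPoly L) := by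
  have hF : ∏ M ∈ s, definingPoly M ∣
      θ (definingPoly H) * definingPoly L - θ (definingPoly L) * definingPoly H := by
    refine Finset.prod_dvd_of_isRelPrime (pairwise_isRelPrime_definingPoly _ hs) fun M hM => ?_
    have hM' := mem_deletion.1 (hs hM)
    obtain ⟨c, t, ht, hMeq⟩ :=
      exists_definingPoly_eq_of_inf_eq_inf hH hL hM'.2 hM'.1 (hsL M hM)
    refine (((isUnit_iff_ne_zero.2 ht).map
      (C : K →+* MvPolynomial (Fin 3) K)).dvd_mul_left).1 ?_
    have hder : θ (definingPoly M) = C c * θ (definingPoly H) + C t * θ (definingPoly L) := by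
      rw [hMeq, map_add, der_C_mul, der_C_mul]
    have : C t * (θ (definingPoly H) * definingPoly L - θ (definingPoly L) * definingPoly H) =
        θ (definingPoly H) * definingPoly M - definingPoly H * θ (definingPoly M) := by
      rw [hder, hMeq]; ring
    rw [this]
    exact dvd_sub (dvd_mul_left _ _) ((mem_logDer.1 hθ M (hs hM)).mul_left _)
  have := map_dvd (elim a j) hF
  rw [map_prod, map_sub, map_mul, map_mul, (elim_eq_zero_iff (f := definingPoly H) hj).2
    (by rw [hp]), mul_zero, sub_zero] at this
  exact this

lemma exists_isReduction (hH : H ∈ A.hyperplanes) :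
    ∃ p i k R N, A.IsReduction H p i k R N := by
  classical
  obtain ⟨a, ha0, ha, hp⟩ := exists_definingPoly_eq (A.isHyperplane H hH)
  obtain ⟨j, hj⟩ := exists_apply_single_ne_zero ha0
  have hrep : ∀ Y, ∃ L, Y ∈ A.restriction H → L ≠ H ∧ L ∈ A.hyperplanes ∧ H ⊓ L = Y := by
    intro Y
    by_cases hY : Y ∈ A.restriction H
    · obtain ⟨L, hL⟩ := mem_restriction.1 hY
      exact ⟨L, fun _ => hL⟩
    -- An arbitrary value outside A^H, never used.
    · exact ⟨⊥, fun h => absurd h hY⟩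
  choose rep hrep using hrep
  have hrel : ∀ {L M}, L ∈ A.hyperplanes → L ≠ H → M ∈ A.hyperplanes → M ≠ H →
      H ⊓ L ≠ H ⊓ M → IsRelPrime (elim a j (definingPoly L)) (elim a j (definingPoly M)) :=
    fun hL hLH hM hMH hne =>
      (prime_elim_definingPoly hH hp hj hL hLH).irreducible.isRelPrime_iff_not_dvd.2
        fun h => hne (inf_eq_inf_of_elim_dvd hH hp ha hj hL hLH hM hMH h)
  refine ⟨elim a j, j + 1, j + 2, ∏ Y ∈ A.restriction H, elim a j (definingPoly (rep Y)),
    ∏ M ∈ (A.deletion H).hyperplanes, elim a j (definingPoly M),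
    fun f => by rw [elim_eq_zero_iff hj, hp], isHomogeneous_elim a j, ?_, ?_, ?_, ?_, ?_, ?_,
    exists_eq_smul_eulerDer_add hp hH hj⟩
  · exact Finset.prod_ne_zero_iff.2 fun Y hY =>
      elim_definingPoly_ne_zero hH hp hj (hrep Y hY).2.1 (hrep Y hY).1
  · simpa using IsHomogeneous.prod (A.restriction H) _ (fun _ => 1)
      fun Y _ => isHomogeneous_elim a j (isHomogeneous_definingPoly (rep Y))
  · exact Finset.prod_ne_zero_iff.2 fun M hM =>
      elim_definingPoly_ne_zero hH hp hj (mem_deletion.1 hM).2 (mem_deletion.1 hM).1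
  · simpa using IsHomogeneous.prod (A.deletion H).hyperplanes _ (fun _ => 1)
      fun M _ => isHomogeneous_elim a j (isHomogeneous_definingPoly M)
  · intro θ hθ
    refine Finset.prod_dvd_of_isRelPrime (fun Y hY Z hZ hne => ?_) fun Y hY =>
      elim_definingPoly_dvd_minor hH hp hj (hrep Y hY).2.1 (hrep Y hY).1 hθ
    obtain ⟨h1, h2, h3⟩ := hrep Y hY
    obtain ⟨h4, h5, h6⟩ := hrep Z hZ
    exact hrel h2 h1 h5 h4 (by rwa [h3, h6])
  · intro θ hθ
    -- N is grouped by the lines H ∩ L; forms from different groups stay coprime on H.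
    rw [← Finset.prod_fiberwise_of_maps_to (t := A.restriction H) (g := fun L => H ⊓ L)
      fun M hM => mem_restriction.2 ⟨M, (mem_deletion.1 hM).1, (mem_deletion.1 hM).2, rfl⟩]
    refine Finset.prod_dvd_of_isRelPrime (fun Y hY Z hZ hne => ?_) fun Y hY => ?_
    · refine IsRelPrime.prod_left fun L hL => IsRelPrime.prod_right fun M hM => ?_
      rw [Finset.mem_filter, mem_deletion] at hL hM
      exact hrel hL.1.2 hL.1.1 hM.1.2 hM.1.1 (by rwa [hL.2, hM.2])
    · refine (prod_fiber_dvd hH hp hj (hrep Y hY).2.1 (Finset.filter_subset _ _)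
        (fun M hM => ?_) hθ).trans (mul_dvd_mul_left _ (Finset.dvd_prod_of_mem _ hY))
      rw [(hrep Y hY).2.2, (Finset.mem_filter.1 hM).2]

end HyperplaneArrangement

/-! ### Counting the restriction by degrees -/

namespace HyperplaneArrangement

variable {K : Type*} [Field K] {A : HyperplaneArrangement K 3} {H : Submodule K (Fin 3 → K)}

lemma eulerDet_swap (φ ψ : Der K 3) : eulerDet ψ φ = -eulerDet φ ψ := by
  rw [eulerDet_eq, eulerDet_eq]; ring

lemma eulerDet_smul_left (f : MvPolynomial (Fin 3) K) (φ ψ : Der K 3) :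
    eulerDet (f • φ) ψ = f * eulerDet φ ψ := by
  simp only [eulerDet_eq, Derivation.smul_apply, smul_eq_mul]; ring

lemma eulerDet_smul_eulerDer_add_smul (g f : MvPolynomial (Fin 3) K) (φ ψ : Der K 3) :
    eulerDet φ (g • eulerDer K 3 + f • ψ) = f * eulerDet φ ψ := by
  simp only [eulerDet_eq, Derivation.add_apply, Derivation.smul_apply, eulerDer_X, smul_eq_mul]
  ring

lemma isNonEuler_of_eulerDet_ne_zero {φ ψ : Der K 3} (h : eulerDet φ ψ ≠ 0) : IsNonEuler ψ := by
  rintro g rfl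
  apply h
  simp only [eulerDet_eq, Derivation.smul_apply, eulerDer_X, smul_eq_mul]
  ring

/-- A single plane in K³ is not the origin. Nonemptiness makes |A'| invertible in K, as `r_eq_sInf`
requires. -/
lemma IsEssential.deletion_nonempty (hA : A.IsEssential) (hH : H ∈ A.hyperplanes) :
    (A.deletion H).hyperplanes.Nonempty := by
  by_contra hne
  have hall : ∀ L ∈ A.hyperplanes, L = H := by
    intro L hL
    by_contra hLH
    exact hne ⟨L, mem_deletion.2 ⟨hLH, hL⟩⟩
  have hbot : H = ⊥ := by
    rw [eq_bot_iff, ← hA]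
    exact le_iInf₂ fun L hL => (hall L hL).ge
  obtain ⟨a, -, ha⟩ := A.isHyperplane H hH
  have hinj : Function.Injective a := LinearMap.ker_eq_bot.1 (ha.trans hbot)
  have := LinearMap.finrank_le_finrank_of_injective hinj
  simp at this

/-- If `D(A ∖ {H})` contains homogeneous `φ` and `ψ` with `det (θ_E, φ, ψ) = Q(A ∖ {H})`, up to a
nonzero constant, and `ψ` lies in `D(A)`, then `A^H` has `1 + deg ψ` elements. -/
lemma card_restriction_eq (hH : H ∈ A.hyperplanes) {φ ψ : Der K 3} {e f : ℕ}
    (hφ : φ ∈ (A.deletion H).logDer) (he : IsHomogeneousDer φ e)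
    (hψ : ψ ∈ A.logDer) (hf : IsHomogeneousDer ψ f) {c : K} (hc : c ≠ 0)
    (hdet : eulerDet φ ψ = C c * (A.deletion H).Q) : (A.restriction H).card = 1 + f := by
  obtain ⟨p, i, k, R, N, hp⟩ := exists_isReduction hH
  have h0 : eulerDet φ ψ ≠ 0 := by
    rw [hdet]; exact mul_ne_zero (by simpa using hc) Q_ne_zero
  have hndvd : ¬ definingPoly H ∣ eulerDet φ ψ := by
    rw [hdet]
    intro h
    exact not_definingPoly_dvd_Q_deletion hH
      ((((isUnit_iff_ne_zero.2 hc).map (C : K →+* MvPolynomial (Fin 3) K)).dvd_mul_left).1 h)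
  have hcard : 1 + e + f = (A.deletion H).hyperplanes.card :=
    (isHomogeneous_eulerDet he hf).inj_right (hdet ▸ (isHomogeneous_Q _).C_mul c) h0
  -- If φ(α_H) vanished on H, all three rows would preserve α_H and it would divide the determinant.
  have hge : (A.deletion H).hyperplanes.card ≤ e + (A.restriction H).card := by
    refine hp.N_hom.le_of_dvd ?_ (mul_ne_zero (fun h => hndvd ?_) hp.R_ne_zero) (hp.N_dvd hφ)
    · exact (hp.hom (he _ (isHomogeneous_definingPoly H))).mul hp.R_hom
    · exact definingPoly_dvd_eulerDet hH ((hp.eq_zero_iff _).1 h) (mem_logDer.1 hψ H hH)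
  -- If the minor vanished, ψ would be α_H ψ' modulo θ_E and α_H would again divide the determinant.
  have hle : (A.restriction H).card ≤ f + 1 := by
    refine hp.R_hom.le_of_dvd ?_ (fun h => ?_) (hp.R_dvd hψ)
    · exact ((hp.hom (isHomogeneousDer_iff.1 hf i)).mul (isHomogeneous_X K k)).sub
        ((hp.hom (isHomogeneousDer_iff.1 hf k)).mul (isHomogeneous_X K i))
    · obtain ⟨g, ψ', d, -, -, rfl⟩ :=
        hp.exists_eq hψ hf (isNonEuler_of_eulerDet_ne_zero h0) (sub_eq_zero.1 h)
      rw [eulerDet_smul_eulerDer_add_smul] at hndvd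
      exact hndvd (dvd_mul_right _ _)
  omega

/-! ### Bounds on r and the critical cardinalities -/

namespace IsSaitoPair

variable {d₂ d₃ : ℕ} {θ₂ θ₃ : Der K 3}

/-- A homogeneous `K`-linear map on derivations with values in the multiples of a form whose
degree is that of the value at `θ₃` has a zero of degree `d₂` outside the multiples of the Euler
derivation. -/
lemma exists_apply_eq_zero (h : A.IsSaitoPair d₂ d₃ θ₂ θ₃) (hd : d₂ ≤ d₃)
    {F : Der K 3 → MvPolynomial (Fin 3) K} {s : ℕ} {P : MvPolynomial (Fin 3) K}
    (hF : ∀ (c c' : K) (θ φ : Der K 3),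
      F ((C c : MvPolynomial (Fin 3) K) • θ + (C c' : MvPolynomial (Fin 3) K) • φ) =
        C c * F θ + C c' * F φ)
    (hFhom : ∀ {θ : Der K 3} {e : ℕ}, IsHomogeneousDer θ e → (F θ).IsHomogeneous (e + s))
    (hP : P.IsHomogeneous (d₃ + s)) (hP0 : P ≠ 0) (hPF : ∀ {θ}, θ ∈ A.logDer → P ∣ F θ) :
    ∃ θ ∈ A.logDer, IsNonEuler θ ∧ IsHomogeneousDer θ d₂ ∧ F θ = 0 := by
  by_cases h2 : F θ₂ = 0
  · exact ⟨θ₂, h.mem₂, h.isNonEuler₂, h.hom₂, h2⟩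
  have hdd : d₂ = d₃ := by
    have := hP.le_of_dvd (hFhom h.hom₂) h2 (hPF h.mem₂)
    omega
  subst hdd
  obtain ⟨c, hc⟩ := hP.exists_eq_C_mul_of_dvd (hFhom h.hom₂) hP0 (hPF h.mem₂)
  obtain ⟨c', hc'⟩ := hP.exists_eq_C_mul_of_dvd (hFhom h.hom₃) hP0 (hPF h.mem₃)
  have hc0 : c ≠ 0 := by
    rintro rfl
    exact h2 (by rw [hc, C_0, zero_mul])
  refine ⟨(C (-c') : MvPolynomial (Fin 3) K) • θ₂ + (C c : MvPolynomial (Fin 3) K) • θ₃,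
    add_mem (Submodule.smul_mem _ _ h.mem₂) (Submodule.smul_mem _ _ h.mem₃),
    h.isNonEuler_smul_add_smul (Or.inr (by simpa using hc0)),
    (h.hom₂.C_smul _).add (h.hom₃.C_smul _), ?_⟩
  rw [hF, hc, hc', C_neg]
  ring

variable [CharZero K]

lemma r_deletion_le (h : A.IsSaitoPair d₂ d₃ θ₂ θ₃)
    (hne : (A.deletion H).hyperplanes.Nonempty) : (A.deletion H).r ≤ d₂ :=
  r_le hne (logDer_le_logDer_deletion h.mem₂) h.isNonEuler₂ h.hom₂

lemma exists_mem_logDer_deletion (h : A.IsSaitoPair d₂ d₃ θ₂ θ₃) (hH : H ∈ A.hyperplanes)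
    (hne : (A.deletion H).hyperplanes.Nonempty) :
    ∃ φ ∈ (A.deletion H).logDer, IsHomogeneousDer φ (A.deletion H).r ∧
      definingPoly H • φ ∈ A.logDer ∧ IsNonEuler (definingPoly H • φ) ∧
      IsHomogeneousDer (definingPoly H • φ) (1 + (A.deletion H).r) := by
  obtain ⟨φ, hφ, hφne, hφhom⟩ := exists_isHomogeneousDer_r hne
    (logDer_le_logDer_deletion h.mem₂) h.isNonEuler₂ h.hom₂
  exact ⟨φ, hφ, hφhom, smul_mem_logDer hφ, hφne.definingPoly_smul (by norm_num) hH,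
    hφhom.smul (isHomogeneous_definingPoly H)⟩

lemma le_r_deletion_add_one (h : A.IsSaitoPair d₂ d₃ θ₂ θ₃) (hd : d₂ ≤ d₃)
    (hH : H ∈ A.hyperplanes) (hne : (A.deletion H).hyperplanes.Nonempty) :
    d₂ ≤ 1 + (A.deletion H).r := by
  obtain ⟨φ, -, -, hmem, hE, hhom⟩ := h.exists_mem_logDer_deletion hH hne
  exact h.le_of_isNonEuler hd hmem hE hhom

/-- Here α_H φ has degree d₂ and replaces θ₂; cancelling α_H in its determinant leaves Q(A'). -/
lemma card_restriction_of_r_deletion (h : A.IsSaitoPair d₂ d₃ θ₂ θ₃) (hd : d₂ ≤ d₃)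
    (hH : H ∈ A.hyperplanes) (hne : (A.deletion H).hyperplanes.Nonempty)
    (hr : 1 + (A.deletion H).r = d₂) : (A.restriction H).card = 1 + d₃ := by
  obtain ⟨φ, hφ, hφhom, hmem, hE, hhom⟩ := h.exists_mem_logDer_deletion hH hne
  obtain ⟨ψ, hψ, hψhom, c, hc, hdet⟩ := h.exists_eulerDet_eq hd hmem hE (hr ▸ hhom)
  refine card_restriction_eq hH hφ hφhom hψ hψhom hc
    (mul_left_cancel₀ (prime_definingPoly hH).ne_zero ?_)
  rw [← eulerDet_smul_left, hdet, Q_deletion hH]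
  ring

lemma r_deletion_of_card_restriction (h : A.IsSaitoPair d₂ d₃ θ₂ θ₃) (hd : d₂ ≤ d₃)
    (hH : H ∈ A.hyperplanes) (hne : (A.deletion H).hyperplanes.Nonempty)
    (hcard : (A.restriction H).card = 1 + d₃) : 1 + (A.deletion H).r ≤ d₂ := by
  obtain ⟨p, i, k, R, N, hp⟩ := exists_isReduction hH
  obtain ⟨θ, hθ, hE, hhom, hzero⟩ := h.exists_apply_eq_zero hd
    (F := fun θ => p (θ (X i)) * X k - p (θ (X k)) * X i) (s := 1) (P := R)
    (by
      intro c c' θ φ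
      have hpC : ∀ x : K, p (C x) = C x := fun x => p.commutes x
      simp only [Derivation.add_apply, Derivation.smul_apply, smul_eq_mul, map_add, map_mul, hpC]
      ring)
    (fun he => ((hp.hom (isHomogeneousDer_iff.1 he i)).mul (isHomogeneous_X K k)).sub
        ((hp.hom (isHomogeneousDer_iff.1 he k)).mul (isHomogeneous_X K i)))
    (by have := hp.R_hom; rwa [hcard, add_comm] at this) hp.R_ne_zero hp.R_dvd
  obtain ⟨g, φ, d, rfl, hφhom, rfl⟩ := hp.exists_eq hθ hhom hE (sub_eq_zero.1 hzero)
  have hmem : definingPoly H • φ ∈ A.logDer :=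
    (Submodule.add_mem_iff_right _ (Submodule.smul_mem _ g eulerDer_mem_logDer)).1 hθ
  have hφE : IsNonEuler φ := by
    rintro g' rfl
    exact hE (g + definingPoly H * g') (by rw [add_smul, mul_smul])
  have := r_le hne (mem_logDer_deletion_of_smul hH hmem) hφE hφhom
  omega

lemma r_le_add_one (h : (A.deletion H).IsSaitoPair d₂ d₃ θ₂ θ₃) (hH : H ∈ A.hyperplanes) :
    A.r ≤ 1 + d₂ :=
  r_le ⟨H, hH⟩ (smul_mem_logDer h.mem₂) (h.isNonEuler₂.definingPoly_smul (by norm_num) hH)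
    (h.hom₂.smul (isHomogeneous_definingPoly H))

lemma exists_mem_logDer (h : (A.deletion H).IsSaitoPair d₂ d₃ θ₂ θ₃) (hH : H ∈ A.hyperplanes) :
    ∃ φ ∈ A.logDer, IsNonEuler φ ∧ IsHomogeneousDer φ A.r :=
  exists_isHomogeneousDer_r ⟨H, hH⟩ (smul_mem_logDer h.mem₂)
    (h.isNonEuler₂.definingPoly_smul (by norm_num) hH)
    (h.hom₂.smul (isHomogeneous_definingPoly H))

lemma le_r (h : (A.deletion H).IsSaitoPair d₂ d₃ θ₂ θ₃) (hd : d₂ ≤ d₃)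
    (hH : H ∈ A.hyperplanes) : d₂ ≤ A.r := by
  obtain ⟨φ, hφ, hE, hhom⟩ := h.exists_mem_logDer hH
  exact h.le_of_isNonEuler hd (logDer_le_logDer_deletion hφ) hE hhom

lemma card_restriction_of_r (h : (A.deletion H).IsSaitoPair d₂ d₃ θ₂ θ₃) (hd : d₂ ≤ d₃)
    (hH : H ∈ A.hyperplanes) (hr : A.r = d₂) : (A.restriction H).card = 1 + d₂ := by
  obtain ⟨φ, hφ, hE, hhom⟩ := h.exists_mem_logDer hH
  rw [hr] at hhom
  obtain ⟨ψ, hψ, hψhom, c, hc, hdet⟩ :=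
    h.exists_eulerDet_eq hd (logDer_le_logDer_deletion hφ) hE hhom
  refine card_restriction_eq hH hψ hψhom hφ hhom (neg_ne_zero.2 hc) ?_
  rw [eulerDet_swap, hdet, C_neg, neg_mul]

/-- N has degree 1 + d₂ + d₃, exactly that expected of θ₃(α_H) R, so some θ of degree d₂ has θ(α_H)
≡ 0 modulo α_H. -/
lemma r_of_card_restriction (h : (A.deletion H).IsSaitoPair d₂ d₃ θ₂ θ₃) (hd : d₂ ≤ d₃)
    (hH : H ∈ A.hyperplanes) (hcard : (A.restriction H).card = 1 + d₂) : A.r ≤ d₂ := by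
  obtain ⟨p, i, k, R, N, hp⟩ := exists_isReduction hH
  obtain ⟨θ, hθ, hE, hhom, hzero⟩ := h.exists_apply_eq_zero hd
    (F := fun θ => p (θ (definingPoly H)) * R) (s := 1 + d₂) (P := N)
    (by
      intro c c' θ φ
      have hpC : ∀ x : K, p (C x) = C x := fun x => p.commutes x
      simp only [Derivation.add_apply, Derivation.smul_apply, smul_eq_mul, map_add, map_mul, hpC]
      ring)
    (fun he => hcard ▸ (hp.hom (he _ (isHomogeneous_definingPoly H))).mul hp.R_hom)
    (by have := hp.N_hom; rwa [h.card_eq, add_comm] at this) hp.N_ne_zero hp.N_dvd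
  have hdvd := (hp.eq_zero_iff _).1 ((mul_eq_zero.1 hzero).resolve_right hp.R_ne_zero)
  exact r_le ⟨H, hH⟩ (mem_logDer_of_deletion hθ hdvd) hE hhom

end IsSaitoPair

end HyperplaneArrangement

end

theorem theorem3p4 {K : Type*} [Field K] [CharZero K]
    (A : HyperplaneArrangement K 3) (hA : A.IsEssential)
    (H : Submodule K (Fin 3 → K)) (hH : H ∈ A.hyperplanes)
    (d₂ d₃ : ℕ) (hd : d₂ ≤ d₃) :
    (A.IsFreeWithExponents ![1, d₂, d₃] →
      (((A.deletion H).r : ℤ) = (d₂ : ℤ) - 1 ↔ (A.restriction H).card = 1 + d₃) ∧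
      ((A.restriction H).card ≠ 1 + d₃ → (A.deletion H).r = d₂)) ∧
    ((A.deletion H).IsFreeWithExponents ![1, d₂, d₃] →
      (A.r = d₂ + 1 ↔ (A.restriction H).card ≠ 1 + d₂) ∧
      ((A.restriction H).card = 1 + d₂ → A.r = d₂)) := by
  have hne := hA.deletion_nonempty hH
  constructor
  · intro hfree
    obtain ⟨θ₂, θ₃, h⟩ := hfree.exists_isSaitoPair ⟨H, hH⟩
    have h1 := h.r_deletion_le hne
    have h2 := h.le_r_deletion_add_one hd hH hne
    have h3 := h.card_restriction_of_r_deletion hd hH hne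
    have h4 := h.r_deletion_of_card_restriction hd hH hne
    -- The bounds leave r = d₂ or 1 + r = d₂; the latter form avoids truncated subtraction.
    omega
  · intro hfree
    obtain ⟨θ₂, θ₃, h⟩ := hfree.exists_isSaitoPair hne
    have h1 := h.r_le_add_one hH
    have h2 := h.le_r hd hH
    have h3 := h.card_restriction_of_r hd hH
    have h4 := h.r_of_card_restriction hd hH
    omega
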